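/- Let $b$ be a prime, $s,m\ge 1$ integers, $S=\{1,\dots,s\}$. For $\boldsymbol j,\boldsymbol l\in\mathbb Z^s$ let $J=J_{\boldsymbol j,\boldsymbol l}=\prod_{i=1}^s[b^{j_i}l_i,b^{j_i}(l_i+1))$ and, for $u\subseteq S$, $J_u=\prod_{i\in u}[b^{j_i}l_i,b^{j_i}(l_i+1))$. **Function class.** For $1\le i\le s$ let $D_i\subseteq\mathbb Z^2$ be such that the intervals $[b^jl,b^j(l+1))$, $(j,l)\in D_i$, form a partition of $\mathbb R$, and let $\boldsymbol D=\prod_i D_i$; the boxes $J_{\boldsymbol j,\boldsymbol l}$, $(\boldsymbol j,\boldsymbol l)\in\boldsymbol D$, partition $\mathbb R^s$. For every $u\subseteq S$ let $\gamma_u$ be a bounded function of these boxes with positive values, and for every nonempty $u\subseteq S$ let $\alpha_u$ be a real function of these boxes with $\sup_J\alpha_u(J)\le1$ and $\inf_J\alpha_u(J)>1/2$. For a continuous $f:\mathbb R^s\to\mathbb R$ and nonempty $u$ put $f_u(\boldsymbol x_u)=\int_{J_{S\setminus u}}f(\boldsymbol x)\,d\boldsymbol x_{S\setminus u}$ and $$V^{(|u|)}_{\alpha,J}(f_u;u)=\sup_{\mathcal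 P}\Big(\sum_{I\in\mathcal P}\mathrm{Vol}(I)\Big|\frac{\Delta(f_u,I)}{\mathrm{Vol}(I)^{\alpha}}\Big|^2\Big)^{1/2},$$ where $\mathcal P$ runs over the partitions of $J_u$ into finitely many boxes $I=\prod_{i\in u}[x_i,y_i)$, $x_i<y_i$, and $\Delta(f_u,I)$ is the alternating sum of $f_u$ over the vertices of $I$; for $u=\emptyset$ put $V^{(0)}_{\alpha,J}(f_\emptyset;\emptyset)=(\int_J|f|^2)^{1/2}$. Let $$V_{\boldsymbol\alpha,\boldsymbol\gamma}(f)=\Big(\sum_{J}\sum_{u\subseteq S}\big[\gamma_u(J)^{-1}V^{(|u|)}_{\alpha_u(J),J}(f_u;u)\big]^2\Big)^{1/2},$$ the sum being over the boxes $J$ of the partition, and let $H_{\boldsymbol\alpha,\boldsymbol\gamma}$ be the set of continuous $f$ with $V_{\boldsymbol\alpha,\boldsymbol\gamma}(f)<\infty$. For a quadrature rule $Q$ let $e(H_{\boldsymbol\alpha,\boldsymbol\gamma},Q)=\sup\big|Q(f)-\int_{\mathbb R^s}f\big|$ over all $f\in H_{\boldsymbol\alpha,\boldsymbol\gamma}$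 with $V_{\boldsymbol\alpha,\boldsymbol\gamma}(f)\le1$. **Points.** For each $i$ choose $\Delta_i$ distinct pairs $(j_{i,d},l_{i,d})\in D_i$, $1\le d\le\Delta_i$, and integers $t\le m_{i,\Delta_i}\le\dots\le m_{i,1}\le m$ with $\sum_{d}b^{m_{i,d}}=b^m$. Define the look-up table $z_{i,0},\dots,z_{i,b^m-1}$ by $z_{i,\,b^{m_{i,1}}+\dots+b^{m_{i,d-1}}+k}=b^{j_{i,d}}l_{i,d}+k\,b^{j_{i,d}-m_{i,d}}$ for $1\le d\le\Delta_i$, $0\le k<b^{m_{i,d}}$. Let $C_1,\dots,C_s\in\mathbb Z_b^{m\times m}$ generate a digital $(t,m,s)$-net: for $0\le n=n_0+n_1b+\dots+n_{m-1}b^{m-1}<b^m$ with base-$b$ digits $n_r$ put $(\eta_{n,i,0},\dots,\eta_{n,i,m-1})^\top=C_i(n_0,\dots,n_{m-1})^\top$ and $\eta_{n,i}=\sum_{r=0}^{m-1}\eta_{n,i,r}b^{m-1-r}$; then $0\le t\le m$ and every box $\prod_i[a_ib^{-k_i},(a_i+1)b^{-k_i})$ with integers $k_i\ge0$, $0\le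 a_i<b^{k_i}$ and $\sum_ik_i=m-t$ contains exactly $b^t$ of the points $(\eta_{n,1}b^{-m},\dots,\eta_{n,s}b^{-m})$, counted with multiplicity. Let $\boldsymbol x_n=(z_{1,\eta_{n,1}},\dots,z_{s,\eta_{n,s}})$. For $\boldsymbol d\in\prod_i\{1,\dots,\Delta_i\}$ let $m_{\boldsymbol d}=m-\sum_{i}(m-m_{i,d_i})$, and let $\boldsymbol F\subseteq\boldsymbol D$ be the set of $(\boldsymbol j,\boldsymbol l)=((j_{1,d_1},\dots,j_{s,d_s}),(l_{1,d_1},\dots,l_{s,d_s}))$ with $m_{\boldsymbol d}\ge t$. Let $Q(f)=\sum_n\lambda_nf(\boldsymbol x_n)$, the sum being over those $n$ for which $\boldsymbol x_n$ lies in a box $J_{\boldsymbol j,\boldsymbol l}$ with $(\boldsymbol j,\boldsymbol l)\in\boldsymbol F$, with the locally equal weights $\lambda_n=\mathrm{Vol}(J)/N_J$ for $\boldsymbol x_n\in J$, where $N_J$ is the number of $n$ with $\boldsymbol x_n\in J$. (Points outside the boxes of $\boldsymbol F$ are not used. If there are none, $Q$ is the rule that uses all $b^m$ points.) **Theorem.**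 $$e(H_{\boldsymbol\alpha,\boldsymbol\gamma},Q)\le\sum_{(\boldsymbol j,\boldsymbol l)\in\boldsymbol D\setminus\boldsymbol F}b^{(j_1+\dots+j_s)/2}\gamma_\emptyset(J)+\sum_{\emptyset\ne u\subseteq S}\ \sum_{(\boldsymbol j,\boldsymbol l)\in\boldsymbol F}\gamma_u(J)\,C_{u,J}\,b^{-\alpha_u(J)(m_{\boldsymbol d}-t)}\binom{m_{\boldsymbol d}-t+|u|}{|u|-1},$$ where $J=J_{\boldsymbol j,\boldsymbol l}$, $\boldsymbol d$ is the index of $(\boldsymbol j,\boldsymbol l)\in\boldsymbol F$, and $$C_{u,J}=(b-1)^{(\alpha_u(J)-1/2)|u|}\,b^{|u|/2}\,b^{1/2-\alpha_u(J)}\,b^{(\alpha_u(J)+1/2)\sum_{i\in u}j_i}.$$ The right-hand side may be $+\infty$; if the first sum is finite, every $f\in H_{\boldsymbol\alpha,\boldsymbol\gamma}$ is integrable over $\mathbb R^s$. -/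

import Mathlib

open MeasureTheory
open scoped ENNReal

noncomputable section

namespace QMCNet

/-! ### `b`-adic intervals, boxes and product partitions -/

/-- The `b`-adic interval `[b^j l, b^j (l+1))` of the real line encoded by the pair `(j, l)`. -/
def interval (b : ℕ) (q : ℤ × ℤ) : Set ℝ :=
  Set.Ico ((b : ℝ) ^ q.1 * q.2) ((b : ℝ) ^ q.1 * (q.2 + 1))

/-- The box `∏_i [b^{j_i} l_i, b^{j_i} (l_i+1))` encoded by `p i = (j_i, l_i)`. -/
def box {ι : Type*} (b : ℕ) (p : ι → ℤ × ℤ) : Set (ι → ℝ) :=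
  {x | ∀ i, x i ∈ interval b (p i)}

/-- The intervals encoded by `D` form a partition of the real line. -/
def IsPartitionOfReal (b : ℕ) (D : Set (ℤ × ℤ)) : Prop :=
  D.PairwiseDisjoint (interval b) ∧ (⋃ q ∈ D, interval b q) = Set.univ

/-- The codes of the boxes of the product partition `D_1 × ⋯ × D_s`. -/
def prodCodes {s : ℕ} (D : Fin s → Set (ℤ × ℤ)) : Set (Fin s → ℤ × ℤ) :=
  {p | ∀ i, p i ∈ D i}

/-! ### Generalized Vitali and Hardy-Krause variation -/

/-- The alternating sum `Δ(f, I)` of `f` over the vertices of `I = ∏_i [x_i, y_i)`;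
it is `∏_i (f_i(x_i) - f_i(y_i))` for `f = ∏_i f_i`. -/
def altSum {ι : Type*} [Fintype ι] [DecidableEq ι] (f : (ι → ℝ) → ℝ) (x y : ι → ℝ) : ℝ :=
  ∑ v : Finset ι, (-1 : ℝ) ^ v.card * f (fun i => if i ∈ v then y i else x i)

/-- `π` is a finite partition of the set `J` into nondegenerate half-open subintervals,
the interval `∏_i [x_i, y_i)` being encoded by the pair `(x, y)`. -/
def IsBoxPartition {ι : Type*} (J : Set (ι → ℝ)) (π : Finset ((ι → ℝ) × (ι → ℝ))) : Prop :=
  (∀ I ∈ π, ∀ i, I.1 i < I.2 i) ∧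
  ((π : Set ((ι → ℝ) × (ι → ℝ))).PairwiseDisjoint
    fun I => Set.univ.pi fun i => Set.Ico (I.1 i) (I.2 i)) ∧
  (⋃ I ∈ π, Set.univ.pi fun i => Set.Ico (I.1 i) (I.2 i)) = J

/-- Generalized variation in the sense of Vitali of order `α` of `f` in `J`:
`sup_π (∑_{I ∈ π} Vol(I) |Δ(f,I) / Vol(I)^α|^2)^{1/2}`. -/
def vitaliVar {ι : Type*} [Fintype ι] [DecidableEq ι] (α : ℝ) (J : Set (ι → ℝ))
    (f : (ι → ℝ) → ℝ) : ℝ≥0∞ :=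
  ⨆ π : {π : Finset ((ι → ℝ) × (ι → ℝ)) // IsBoxPartition J π},
    (∑ I ∈ π.1, ENNReal.ofReal ((∏ i, (I.2 i - I.1 i)) *
      |altSum f I.1 I.2 / (∏ i, (I.2 i - I.1 i)) ^ α| ^ 2)) ^ (1 / 2 : ℝ)

/-- The point of `ℝ^s` with coordinates `x` in `u` and `y` outside `u`. -/
def glue {s : ℕ} (u : Finset (Fin s)) (x : {i // i ∈ u} → ℝ) (y : {i // i ∉ u} → ℝ) :
    Fin s → ℝ :=
  fun i => if h : i ∈ u then x ⟨i, h⟩ else y ⟨i, h⟩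

/-- `f_u(x_u) = ∫_{J_{S∖u}} f(x) dx_{S∖u}`, where `J` is the box with code `p`. -/
def marginal {s : ℕ} (b : ℕ) (p : Fin s → ℤ × ℤ) (u : Finset (Fin s))
    (f : (Fin s → ℝ) → ℝ) (x : {i // i ∈ u} → ℝ) : ℝ :=
  ∫ y in box b (fun i : {i // i ∉ u} => p i), f (glue u x y)

/-- `V^{(|u|)}_{α,J}(f_u; u)`: the Vitali variation of `f_u` in `J_u` for nonempty `u`,
and the `L_2`-norm of `f` on `J` for empty `u`. -/
def localVar {s : ℕ} (b : ℕ) (α : ℝ) (p : Fin s → ℤ × ℤ) (u : Finset (Fin s))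
    (f : (Fin s → ℝ) → ℝ) : ℝ≥0∞ :=
  if u = ∅ then (∫⁻ x in box b p, ‖f x‖ₑ ^ 2) ^ (1 / 2 : ℝ)
  else vitaliVar α (box b (fun i : {i // i ∈ u} => p i)) (marginal b p u f)

/-- Generalized Hardy-Krause variation
`(∑_J ∑_u [γ_u(J)^{-1} V^{(|u|)}_{α_u(J),J}(f_u; u)]^2)^{1/2}` with respect to the product
partition given by `D`. -/
def hkVar {s : ℕ} (b : ℕ) (D : Fin s → Set (ℤ × ℤ))
    (α γ : Finset (Fin s) → (Fin s → ℤ × ℤ) → ℝ) (f : (Fin s → ℝ) → ℝ) : ℝ≥0∞ :=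
  (∑' p : prodCodes D, ∑ u : Finset (Fin s),
    (ENNReal.ofReal (γ u p)⁻¹ * localVar b (α u p) p u f) ^ 2) ^ (1 / 2 : ℝ)

/-- Local smoothness parameters: for each nonempty `u`,
`sup_J α_u(J) ≤ 1` and `inf_J α_u(J) > 1/2`. -/
def IsLocalSmoothness {s : ℕ} (D : Fin s → Set (ℤ × ℤ))
    (α : Finset (Fin s) → (Fin s → ℤ × ℤ) → ℝ) : Prop :=
  ∀ u : Finset (Fin s), u.Nonempty →
    (∀ p ∈ prodCodes D, α u p ≤ 1) ∧ ∃ c : ℝ, 1 / 2 < c ∧ ∀ p ∈ prodCodes D, c ≤ α u p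

/-- Local weight parameters: positive, and bounded for each `u`. -/
def IsLocalWeight {s : ℕ} (D : Fin s → Set (ℤ × ℤ))
    (γ : Finset (Fin s) → (Fin s → ℤ × ℤ) → ℝ) : Prop :=
  ∀ u : Finset (Fin s),
    (∀ p ∈ prodCodes D, 0 < γ u p) ∧ ∃ c : ℝ, ∀ p ∈ prodCodes D, γ u p ≤ c

/-- The function class `H_{α,γ}`: continuous functions of finite variation. -/
def spaceH {s : ℕ} (b : ℕ) (D : Fin s → Set (ℤ × ℤ))
    (α γ : Finset (Fin s) → (Fin s → ℤ × ℤ) → ℝ) : Set ((Fin s → ℝ) → ℝ) :=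
  {f | Continuous f ∧ hkVar b D α γ f < ∞}

/-! ### Digital nets -/

/-- The vector of the first `m` base `b` digits of `n`, least significant digit first. -/
def digitVec (b m n : ℕ) : Fin m → ZMod b :=
  fun r => ((n / b ^ (r : ℕ) % b : ℕ) : ZMod b)

/-- `η_n = η_{n,0} b^{m-1} + η_{n,1} b^{m-2} + ⋯ + η_{n,m-1}`, where `(η_{n,r})_r` is the
product of the matrix `C` with the digit vector of `n`. -/
def netLabel {b m : ℕ} (C : Matrix (Fin m) (Fin m) (ZMod b)) (n : ℕ) : ℕ :=
  ∑ r : Fin m, (C.mulVec (digitVec b m n) r).val * b ^ (m - 1 - (r : ℕ))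

/-- `C_1, …, C_s` generate a digital `(t,m,s)`-net over `ℤ_b`: of the points
`(η_{n,1}/b^m, …, η_{n,s}/b^m)`, `0 ≤ n < b^m`, exactly `b^t` lie in each elementary interval
`∏_i [a_i b^{-k_i}, (a_i+1) b^{-k_i})` of volume `b^{t-m}` contained in `[0,1)^s`. -/
def IsDigitalNet {b m s : ℕ} (t : ℕ) (C : Fin s → Matrix (Fin m) (Fin m) (ZMod b)) : Prop :=
  t ≤ m ∧ ∀ k a : Fin s → ℕ, (∑ i, k i) + t = m → (∀ i, a i < b ^ k i) →
    Set.ncard {n : Fin (b ^ m) | ∀ i, (netLabel (C i) n : ℝ) / (b : ℝ) ^ m ∈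
      Set.Ico ((a i : ℝ) / (b : ℝ) ^ k i) (((a i : ℝ) + 1) / (b : ℝ) ^ k i)} = b ^ t

/-! ### The mapped point set -/

/-- First label of the `d`-th interval: `b^{m_1} + ⋯ + b^{m_{d-1}}`. -/
def labelStart {Δ : ℕ} (b : ℕ) (μ : Fin Δ → ℕ) (d : Fin Δ) : ℕ :=
  ∑ d' ∈ Finset.Iio d, b ^ μ d'

/-- The one-dimensional look-up table: the label `b^{m_1} + ⋯ + b^{m_{d-1}} + k` with
`0 ≤ k < b^{m_d}` is mapped to the point `b^{j_d} l_d + k b^{j_d - m_d}` of the `d`-th interval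
(exactly one summand has a true condition if the label is smaller than `∑_d b^{m_d}`). -/
def lookup {Δ : ℕ} (b : ℕ) (e : Fin Δ → ℤ × ℤ) (μ : Fin Δ → ℕ) (η : ℕ) : ℝ :=
  ∑ d : Fin Δ,
    if labelStart b μ d ≤ η ∧ η < labelStart b μ d + b ^ μ d then
      (b : ℝ) ^ (e d).1 * (e d).2 +
        ((η - labelStart b μ d : ℕ) : ℝ) * (b : ℝ) ^ ((e d).1 - (μ d : ℤ))
    else 0

/-- The points `x_n = (z_{1,η_{n,1}}, …, z_{s,η_{n,s}})`, `0 ≤ n < b^m`. -/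
def netPoint {b m s : ℕ} {Δ : Fin s → ℕ} (C : Fin s → Matrix (Fin m) (Fin m) (ZMod b))
    (e : (i : Fin s) → Fin (Δ i) → ℤ × ℤ) (μ : (i : Fin s) → Fin (Δ i) → ℕ)
    (n : Fin (b ^ m)) : Fin s → ℝ :=
  fun i => lookup b (e i) (μ i) (netLabel (C i) n)

/-- `m_d = m - ∑_i (m - m_{i,d_i})`. -/
def mIndex {s : ℕ} {Δ : Fin s → ℕ} (m : ℕ) (μ : (i : Fin s) → Fin (Δ i) → ℕ)
    (d : (i : Fin s) → Fin (Δ i)) : ℤ :=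
  (m : ℤ) - ∑ i, ((m : ℤ) - (μ i (d i) : ℤ))

/-- The code of the box `J_d = ∏_i J_{i,d_i}`. -/
def boxCode {s : ℕ} {Δ : Fin s → ℕ} (e : (i : Fin s) → Fin (Δ i) → ℤ × ℤ)
    (d : (i : Fin s) → Fin (Δ i)) : Fin s → ℤ × ℤ :=
  fun i => e i (d i)

/-- The set `F` of (codes of) boxes `J_d` with `m_d ≥ t`. -/
def goodCodes {s : ℕ} {Δ : Fin s → ℕ} (t m : ℕ) (e : (i : Fin s) → Fin (Δ i) → ℤ × ℤ)
    (μ : (i : Fin s) → Fin (Δ i) → ℕ) : Set (Fin s → ℤ × ℤ) :=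
  {p | ∃ d : (i : Fin s) → Fin (Δ i), (t : ℤ) ≤ mIndex m μ d ∧ p = boxCode e d}

open Classical in
/-- The indices `n` of the points lying in the boxes of `F`. -/
def goodIndices {b m s : ℕ} {Δ : Fin s → ℕ} (t : ℕ)
    (C : Fin s → Matrix (Fin m) (Fin m) (ZMod b)) (e : (i : Fin s) → Fin (Δ i) → ℤ × ℤ)
    (μ : (i : Fin s) → Fin (Δ i) → ℕ) : Finset (Fin (b ^ m)) :=
  Finset.univ.filter fun n => ∃ p ∈ goodCodes t m e μ, netPoint C e μ n ∈ box b p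

/-! ### Quadrature rules and the worst-case error -/

/-- For the quadrature points `x_n`, `n ∈ A`, the weights `lam` are locally equal with respect to
the product partition: `lam n = Vol(J) / N_J` if `x_n` lies in the box `J` of the partition, where
`N_J` is the number of `n ∈ A` with `x_n ∈ J`. -/
def IsLocallyEqualWeights {s : ℕ} {N : Type*} (b : ℕ) (D : Fin s → Set (ℤ × ℤ))
    (x : N → Fin s → ℝ) (A : Finset N) (lam : N → ℝ) : Prop :=
  ∀ p ∈ prodCodes D, ∀ n ∈ A, x n ∈ box b p →
    lam n = (b : ℝ) ^ (∑ i, (p i).1) / (Set.ncard {n' : N | n' ∈ A ∧ x n' ∈ box b p} : ℝ)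

/-- The quadrature rule `f ↦ ∑_{n ∈ A} lam_n f(x_n)`. -/
def quadRule {s : ℕ} {N : Type*} (x : N → Fin s → ℝ) (A : Finset N) (lam : N → ℝ)
    (f : (Fin s → ℝ) → ℝ) : ℝ :=
  ∑ n ∈ A, lam n * f (x n)

/-- The worst-case error of the rule `Q` on the unit ball of `H_{α,γ}`. -/
def worstCaseError {s : ℕ} (b : ℕ) (D : Fin s → Set (ℤ × ℤ))
    (α γ : Finset (Fin s) → (Fin s → ℤ × ℤ) → ℝ) (Q : ((Fin s → ℝ) → ℝ) → ℝ) : ℝ≥0∞ :=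
  ⨆ f ∈ {f | f ∈ spaceH b D α γ ∧ hkVar b D α γ f ≤ 1}, ENNReal.ofReal |Q f - ∫ x, f x|

/-! ### The two parts of the error bound -/

/-- The truncation sum `∑_{(j,l) ∈ D ∖ F} b^{(j_1+⋯+j_s)/2} γ_∅(J)`. -/
def truncationSum {s : ℕ} (b : ℕ) (D : Fin s → Set (ℤ × ℤ)) (F : Set (Fin s → ℤ × ℤ))
    (γ : Finset (Fin s) → (Fin s → ℤ × ℤ) → ℝ) : ℝ≥0∞ :=
  ∑' p : (prodCodes D \ F : Set (Fin s → ℤ × ℤ)),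
    ENNReal.ofReal ((b : ℝ) ^ (((∑ i, (p.1 i).1 : ℤ) : ℝ) / 2) * γ ∅ p)

/-- The constant
`(b-1)^{(α-1/2)|u|} b^{|u|/2} b^{1/2-α} b^{(α+1/2) ∑_{i ∈ u} j_i}`. -/
def errConst {s : ℕ} (b : ℕ) (α : ℝ) (u : Finset (Fin s)) (p : Fin s → ℤ × ℤ) : ℝ :=
  ((b : ℝ) - 1) ^ ((α - 1 / 2) * (u.card : ℝ)) * (b : ℝ) ^ ((u.card : ℝ) / 2) *
    (b : ℝ) ^ (1 / 2 - α) * (b : ℝ) ^ ((α + 1 / 2) * ((∑ i ∈ u, (p i).1 : ℤ) : ℝ))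

/-- The approximation sum: over nonempty `u` and over the boxes `J = J_d` with `m_d ≥ t`, of
`γ_u(J) C b^{-α_u(J)(m_d - t)} binom(m_d - t + |u|, |u| - 1)`. -/
def approximationSum {s : ℕ} {Δ : Fin s → ℕ} (b t m : ℕ)
    (e : (i : Fin s) → Fin (Δ i) → ℤ × ℤ) (μ : (i : Fin s) → Fin (Δ i) → ℕ)
    (α γ : Finset (Fin s) → (Fin s → ℤ × ℤ) → ℝ) : ℝ≥0∞ :=
  ∑ u : Finset (Fin s) with u.Nonempty,
    ∑ d : ((i : Fin s) → Fin (Δ i)) with (t : ℤ) ≤ mIndex m μ d,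
      ENNReal.ofReal (γ u (boxCode e d) * errConst b (α u (boxCode e d)) u (boxCode e d) *
        (b : ℝ) ^ (-(α u (boxCode e d)) * ((mIndex m μ d - t : ℤ) : ℝ)) *
        (((mIndex m μ d - t).toNat + u.card).choose (u.card - 1) : ℝ))

end QMCNet

end

/-!
The error of the rule is split over the boxes of the product partition.

In a box `J` outside `F` no point is used, so the error is `∫_J f`, which Cauchy-Schwarz bounds by
`Vol(J)^{1/2}` times the `L_2`-norm of `f` on `J` (`lintegral_box_le`). These bounds add up to the
truncation sum, and if that sum is finite, they also give integrability (`lintegral_compl_le`).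

In a box `J` of `F` the points inherit from the digital net that every cell of level `a`, i.e. of
side lengths `b^{j_i - a_i}`, contains equally many of them as long as `∑ a_i ≤ M = m_d - t`
(`isLocalNet_netPoint`): each chosen interval receives an elementary interval of labels, because
the numbers of labels `b^{m_{i,d}}` do not increase with `d`. This equidistribution is all that the
proof uses of the net.

Expanding `∏ δ_{x_i} = ∏ (δ_{τ_i} + (δ_{x_i} - δ_{τ_i}))` and averaging over `τ ∈ J` writes the
error in `J` as a sum over nonempty `u` of averages of alternating sums of the marginal `f_u`, with
vertices taken from a net point `x` and from `τ` (`IsLocalNet.abs_error_le`). For a fixed `u`, in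
each direction, let `w^a` have the first `a` base `b` digits of `x` and the remaining ones of `τ`
(`mixDigits`), so that `w^0 = τ`. Then `δ_x - δ_τ` telescopes into the differences
`δ_{w^{a+1}} - δ_{w^a}`, `a < L`, and a tail `δ_x - δ_{w^L}`. Products of such differences in all
directions with total level at most `M` average to zero over the net
(`IsLocalNet.levelSum_eq_zero`). Treating one direction after the other, with `L` the part of `M`
that is left, one takes the tail where the total exceeds `M` and leaves the later directions
unsplit; this gives at most `binom(M + |u| - 1, |u| - 1)` further products
(`IsLocalNet.abs_sum_integral_altSum_le`).

In such a product the vertices that belong to a net point lie in one cell of level `lo`, the vector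
of the lower levels. One box in each of these cells can be completed to a partition of `J_u`, and
by Cauchy-Schwarz the variation bounds the product (`sum_sq_altSum_le`,
`IsLocalNet.abs_levelSum_le`). The points `w^{a+1}` and `w^a` differ in a single digit, hence by at
most `(b - 1) / b` times the side length of a cell of level `a`, which is the source of the powers
of `b - 1` in the bound.
-/

namespace QMCNet

/-! ### Boxes and their cells -/

lemma mem_interval_iff {b : ℕ} (hb : 0 < b) (q : ℤ × ℤ) (x : ℝ) :
    x ∈ interval b q ↔ ⌊x / (b : ℝ) ^ q.1⌋ = q.2 := by
  have hg : (0 : ℝ) < (b : ℝ) ^ q.1 := by positivity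
  rw [interval, Set.mem_Ico, Int.floor_eq_iff, le_div_iff₀ hg, div_lt_iff₀ hg,
    mul_comm (b ^ q.1 : ℝ), mul_comm (b ^ q.1 : ℝ)]

lemma mem_box_iff {ι : Type*} {b : ℕ} (hb : 0 < b) (p : ι → ℤ × ℤ) (x : ι → ℝ) :
    x ∈ box b p ↔ ∀ i, ⌊x i / (b : ℝ) ^ (p i).1⌋ = (p i).2 :=
  forall_congr' fun i => mem_interval_iff hb (p i) (x i)

lemma box_eq_pi {ι : Type*} (b : ℕ) (p : ι → ℤ × ℤ) :
    box b p = Set.univ.pi fun i => interval b (p i) := by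
  ext x; simp [box]

lemma box_eq_pi_Ico {ι : Type*} (b : ℕ) (p : ι → ℤ × ℤ) :
    box b p = Set.univ.pi fun i =>
      Set.Ico ((b : ℝ) ^ (p i).1 * (p i).2) ((b : ℝ) ^ (p i).1 * ((p i).2 + 1)) :=
  box_eq_pi b p

lemma measurableSet_box {ι : Type*} [Countable ι] (b : ℕ) (p : ι → ℤ × ℤ) :
    MeasurableSet (box b p) := by
  rw [box_eq_pi]
  exact MeasurableSet.univ_pi fun i => measurableSet_Ico

lemma volume_box {ι : Type*} [Fintype ι] (b : ℕ) (p : ι → ℤ × ℤ) :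
    volume (box b p) = ENNReal.ofReal (∏ i, (b : ℝ) ^ (p i).1) := by
  rw [box_eq_pi_Ico, volume_pi_pi, ENNReal.ofReal_prod_of_nonneg (fun i _ => by positivity)]
  refine Finset.prod_congr rfl fun i _ => ?_
  rw [Real.volume_Ico]
  congr 1
  ring

lemma volume_box_lt_top {ι : Type*} [Fintype ι] (b : ℕ) (p : ι → ℤ × ℤ) :
    volume (box b p) < ∞ := by
  rw [volume_box]; exact ENNReal.ofReal_lt_top

/-- The sub-boxes of level `a` of a box: the code of the cell with index `κ`, whose side in
direction `i` has length `b^{j_i - a_i}`. -/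
def cell {ι : Type*} (p : ι → ℤ × ℤ) (a : ι → ℕ) (κ : ι → ℤ) : ι → ℤ × ℤ :=
  fun i => ((p i).1 - a i, κ i)

/-- The indices of the cells of level `a` contained in the box with code `p`. -/
noncomputable def cellIndices {ι : Type*} [Fintype ι] [DecidableEq ι] (b : ℕ) (p : ι → ℤ × ℤ)
    (a : ι → ℕ) : Finset (ι → ℤ) :=
  Fintype.piFinset fun i =>
    Finset.Ico ((p i).2 * (b : ℤ) ^ a i) (((p i).2 + 1) * (b : ℤ) ^ a i)

/-- The index of the cell of level `a` that contains the point `x`. -/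
noncomputable def cellIndex {ι : Type*} (b : ℕ) (p : ι → ℤ × ℤ) (a : ι → ℕ) (x : ι → ℝ) : ι → ℤ :=
  fun i => ⌊x i / (b : ℝ) ^ ((p i).1 - (a i : ℤ))⌋

lemma card_cellIndices {ι : Type*} [Fintype ι] [DecidableEq ι] (b : ℕ) (p : ι → ℤ × ℤ)
    (a : ι → ℕ) : (cellIndices b p a).card = b ^ ∑ i, a i := by
  rw [cellIndices, Fintype.card_piFinset, ← Finset.prod_pow_eq_pow_sum]
  refine Finset.prod_congr rfl fun i _ => ?_
  rw [Int.card_Ico]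
  have : ((p i).2 + 1) * (b : ℤ) ^ a i - (p i).2 * (b : ℤ) ^ a i = ((b ^ a i : ℕ) : ℤ) := by
    push_cast; ring
  rw [this, Int.toNat_natCast]

lemma floor_div_zpow_sub {b : ℕ} (hb : 0 < b) (j : ℤ) (a : ℕ) (x : ℝ) :
    ⌊x / (b : ℝ) ^ j⌋ = ⌊x / (b : ℝ) ^ (j - a)⌋ / ((b ^ a : ℕ) : ℤ) := by
  rw [← Int.floor_div_natCast]
  congr 1
  have : (b : ℝ) ≠ 0 := by positivity
  rw [zpow_sub₀ this]
  push_cast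
  rw [zpow_natCast]
  field_simp

lemma mem_box_cell_iff {ι : Type*} {b : ℕ} (hb : 0 < b) (p : ι → ℤ × ℤ) (a : ι → ℕ) (κ : ι → ℤ)
    (x : ι → ℝ) :
    x ∈ box b (cell p a κ) ↔ cellIndex b p a x = κ := by
  rw [mem_box_iff hb, funext_iff]; rfl

lemma mem_cellIndices_iff {ι : Type*} [Fintype ι] [DecidableEq ι] {b : ℕ} (hb : 0 < b)
    (p : ι → ℤ × ℤ) (a : ι → ℕ) (κ : ι → ℤ) :
    κ ∈ cellIndices b p a ↔ ∀ i, κ i / ((b ^ a i : ℕ) : ℤ) = (p i).2 := by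
  rw [cellIndices, Fintype.mem_piFinset]
  refine forall_congr' fun i => ?_
  have : (0 : ℤ) < (b : ℤ) ^ a i := by positivity
  rw [Finset.mem_Ico, Int.ediv_eq_iff_of_pos (by positivity)]
  push_cast
  rw [add_mul, one_mul]

/-- A point of a box lies in exactly one cell of level `a`, and the index of that cell is obtained
by rounding. -/
lemma floor_mem_cellIndices_iff {ι : Type*} [Fintype ι] [DecidableEq ι] {b : ℕ} (hb : 0 < b)
    (p : ι → ℤ × ℤ) (a : ι → ℕ) (x : ι → ℝ) :
    cellIndex b p a x ∈ cellIndices b p a ↔ x ∈ box b p := by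
  rw [mem_cellIndices_iff hb, mem_box_iff hb]
  refine forall_congr' fun i => ?_
  rw [cellIndex, ← floor_div_zpow_sub hb]

lemma box_eq_biUnion_cell {ι : Type*} [Fintype ι] [DecidableEq ι] {b : ℕ} (hb : 0 < b)
    (p : ι → ℤ × ℤ) (a : ι → ℕ) :
    box b p = ⋃ κ ∈ cellIndices b p a, box b (cell p a κ) := by
  ext x
  simp only [Set.mem_iUnion, mem_box_cell_iff hb, exists_prop]
  rw [← floor_mem_cellIndices_iff hb p a]
  simp

lemma pairwiseDisjoint_cell {ι : Type*} {b : ℕ} (hb : 0 < b)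
    (p : ι → ℤ × ℤ) (a : ι → ℕ) (K : Set (ι → ℤ)) :
    K.PairwiseDisjoint fun κ => box b (cell p a κ) := by
  intro κ _ κ' _ hne
  refine Set.disjoint_left.2 fun x hx hx' => hne ?_
  rw [mem_box_cell_iff hb] at hx hx'
  exact hx.symm.trans hx'

/-! ### Algebra of alternating sums -/

section altSum
variable {ι : Type*} [Fintype ι] [DecidableEq ι]

/-- The alternating sum is a difference in each coordinate direction. -/
lemma altSum_eq_sum_sub (f : (ι → ℝ) → ℝ) (x y : ι → ℝ) (i : ι) :
    altSum f x y = ∑ v ∈ (Finset.univ.erase i).powerset, (-1 : ℝ) ^ v.card *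
      (f (Function.update (fun k => if k ∈ v then y k else x k) i (x i)) -
        f (Function.update (fun k => if k ∈ v then y k else x k) i (y i))) := by
  have hu : (Finset.univ : Finset (Finset ι)) = (insert i (Finset.univ.erase i)).powerset := by
    ext v; simp
  have hi : i ∉ Finset.univ.erase i := Finset.notMem_erase i _
  rw [altSum, hu, Finset.sum_powerset_insert hi, ← Finset.sum_add_distrib]
  refine Finset.sum_congr rfl fun v hv => ?_
  have hiv : i ∉ v := fun h => hi (Finset.mem_powerset.1 hv h)
  rw [Finset.card_insert_of_notMem hiv, pow_succ]
  have h1 : (fun k => if k ∈ v then y k else x k) =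
      Function.update (fun k => if k ∈ v then y k else x k) i (x i) := by
    ext k
    by_cases hk : k = i
    · subst hk; simp [hiv]
    · simp [hk]
  have h2 : (fun k => if k ∈ insert i v then y k else x k) =
      Function.update (fun k => if k ∈ v then y k else x k) i (y i) := by
    ext k
    by_cases hk : k = i
    · subst hk; simp
    · simp [hk]
  rw [h2, ← h1]
  ring

lemma altSum_update_add (f : (ι → ℝ) → ℝ) (x y : ι → ℝ) (i : ι) (p q r : ℝ) :
    altSum f (Function.update x i p) (Function.update y i r) =
      altSum f (Function.update x i p) (Function.update y i q) +
        altSum f (Function.update x i q) (Function.update y i r) := by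
  have key : ∀ p r, altSum f (Function.update x i p) (Function.update y i r) =
      ∑ v ∈ (Finset.univ.erase i).powerset, (-1 : ℝ) ^ v.card *
      (f (Function.update (fun k => if k ∈ v then y k else x k) i p) -
        f (Function.update (fun k => if k ∈ v then y k else x k) i r)) := by
    intro p r
    rw [altSum_eq_sum_sub _ _ _ i]
    refine Finset.sum_congr rfl fun v _ => ?_
    have : ∀ c, Function.update (fun k => if k ∈ v then Function.update y i r k else
        Function.update x i p k) i c =
        Function.update (fun k => if k ∈ v then y k else x k) i c := by
      intro c
      ext k
      by_cases hk : k = i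
      · subst hk; simp
      · simp [hk]
    simp [this]
  rw [key, key, key, ← Finset.sum_add_distrib]
  refine Finset.sum_congr rfl fun v _ => ?_
  ring

lemma altSum_eq_zero_of_eq (f : (ι → ℝ) → ℝ) (x y : ι → ℝ) (i : ι) (h : x i = y i) :
    altSum f x y = 0 := by
  rw [altSum_eq_sum_sub _ _ _ i, h]
  simp

/-- Exchanging the two endpoints in one direction changes the sign of the alternating sum. -/
lemma altSum_update_swap (f : (ι → ℝ) → ℝ) (x y : ι → ℝ) (i : ι) :
    altSum f (Function.update x i (y i)) (Function.update y i (x i)) = -altSum f x y := by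
  have h := altSum_update_add f x y i (x i) (y i) (x i)
  rw [Function.update_eq_self, Function.update_eq_self,
    altSum_eq_zero_of_eq f _ _ i (by simp)] at h
  linarith

lemma abs_altSum_inf_sup (f : (ι → ℝ) → ℝ) (x y : ι → ℝ) :
    |altSum f (x ⊓ y) (x ⊔ y)| = |altSum f x y| := by
  have key : ∀ s : Finset ι,
      |altSum f (s.piecewise (x ⊓ y) x) (s.piecewise (x ⊔ y) y)| = |altSum f x y| := by
    intro s
    induction s using Finset.induction_on with
    | empty => simp
    | insert i s hi ih =>
      rw [← ih, Finset.piecewise_insert, Finset.piecewise_insert]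
      rcases le_total (x i) (y i) with h | h
      · have h1 : (x ⊓ y) i = s.piecewise (x ⊓ y) x i := by simp [hi, h]
        have h2 : (x ⊔ y) i = s.piecewise (x ⊔ y) y i := by simp [hi, h]
        rw [h1, h2, Function.update_eq_self, Function.update_eq_self]
      · have h1 : (x ⊓ y) i = s.piecewise (x ⊔ y) y i := by simp [hi, h]
        have h2 : (x ⊔ y) i = s.piecewise (x ⊓ y) x i := by simp [hi, h]
        rw [h1, h2, altSum_update_swap, abs_neg]
  simpa using key Finset.univ

end altSum

/-! ### The variation and boxes chosen in the members of a partition -/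

/-- The end points `P ≤ x ≤ y ≤ Q` of the three consecutive intervals into which a subinterval
`[x, y)` divides `[P, Q)`. -/
def nodes (P x y Q : ℝ) : Fin 4 → ℝ := ![P, x, y, Q]

lemma exists_mem_nodes {P x y Q z : ℝ} (hz : z ∈ Set.Ico P Q) :
    ∃ c : Fin 3, z ∈ Set.Ico (nodes P x y Q c.castSucc) (nodes P x y Q c.succ) := by
  rcases lt_or_ge z x with h | h
  · exact ⟨0, hz.1, h⟩
  · rcases lt_or_ge z y with h' | h'
    · exact ⟨1, h, h'⟩
    · exact ⟨2, h', hz.2⟩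

lemma nodes_unique {P x y Q z : ℝ} (h2 : x ≤ y) {c c' : Fin 3}
    (hc : z ∈ Set.Ico (nodes P x y Q c.castSucc) (nodes P x y Q c.succ))
    (hc' : z ∈ Set.Ico (nodes P x y Q c'.castSucc) (nodes P x y Q c'.succ)) : c = c' := by
  fin_cases c <;> fin_cases c' <;> simp [nodes] at hc hc' ⊢ <;> linarith [hc.1, hc.2, hc'.1, hc'.2]

lemma nodes_subset {P x y Q : ℝ} (h1 : P ≤ x) (h2 : x ≤ y) (h3 : y ≤ Q) (c : Fin 3) :
    Set.Ico (nodes P x y Q c.castSucc) (nodes P x y Q c.succ) ⊆ Set.Ico P Q := by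
  fin_cases c <;> simp only [nodes] <;> apply Set.Ico_subset_Ico <;> simp <;> linarith

section
variable {ι : Type*} [Fintype ι] [DecidableEq ι] {K : Type*}

/-- Boxes chosen inside the members of a finite partition of `J` into boxes, one in each of them,
are members of a partition of `J`: the rest of each member is divided into boxes by extending the
faces of the chosen one. So the sum over the chosen boxes is bounded by the variation. -/
lemma sum_altSum_le_vitaliVar (α : ℝ) (J : Set (ι → ℝ)) (f : (ι → ℝ) → ℝ) (S : Finset K)
    (P Q x y : K → ι → ℝ) (h1 : ∀ κ ∈ S, P κ ≤ x κ) (h2 : ∀ κ ∈ S, x κ ≤ y κ)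
    (h3 : ∀ κ ∈ S, y κ ≤ Q κ)
    (hdisj : (S : Set K).PairwiseDisjoint fun κ => Set.univ.pi fun i => Set.Ico (P κ i) (Q κ i))
    (hJ : (⋃ κ ∈ S, Set.univ.pi fun i => Set.Ico (P κ i) (Q κ i)) = J) :
    (∑ κ ∈ S, ENNReal.ofReal ((∏ i, (y κ i - x κ i)) *
      |altSum f (x κ) (y κ) / (∏ i, (y κ i - x κ i)) ^ α| ^ 2)) ^ (1 / 2 : ℝ) ≤
      vitaliVar α J f := by
  classical
  let F : K × (ι → Fin 3) → (ι → ℝ) × (ι → ℝ) := fun q =>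
    (fun i => nodes (P q.1 i) (x q.1 i) (y q.1 i) (Q q.1 i) (q.2 i).castSucc,
      fun i => nodes (P q.1 i) (x q.1 i) (y q.1 i) (Q q.1 i) (q.2 i).succ)
  let π : Finset ((ι → ℝ) × (ι → ℝ)) :=
    ((S ×ˢ Finset.univ).image F).filter fun I => ∀ i, I.1 i < I.2 i
  -- a point of a small box determines the large box and the position in it
  have huniq : ∀ κ ∈ S, ∀ κ' ∈ S, ∀ (c c' : ι → Fin 3) (z : ι → ℝ),
      (∀ i, z i ∈ Set.Ico ((F (κ, c)).1 i) ((F (κ, c)).2 i)) →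
      (∀ i, z i ∈ Set.Ico ((F (κ', c')).1 i) ((F (κ', c')).2 i)) → κ = κ' ∧ c = c' := by
    intro κ hκ κ' hκ' c c' z hz hz'
    have hκκ : κ = κ' := by
      by_contra hne
      have hd : Disjoint (Set.univ.pi fun i => Set.Ico (P κ i) (Q κ i))
        (Set.univ.pi fun i => Set.Ico (P κ' i) (Q κ' i)) := hdisj hκ hκ' hne
      refine Set.disjoint_left.1 hd (?_ : z ∈ _) ?_
      · exact fun i _ => nodes_subset (h1 κ hκ i) (h2 κ hκ i) (h3 κ hκ i) _ (hz i)
      · exact fun i _ => nodes_subset (h1 κ' hκ' i) (h2 κ' hκ' i) (h3 κ' hκ' i) _ (hz' i)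
    subst hκκ
    exact ⟨rfl, funext fun i => nodes_unique (h2 κ hκ i) (hz i) (hz' i)⟩
  have hπ : IsBoxPartition J π := by
    refine ⟨fun I hI => (Finset.mem_filter.1 hI).2, ?_, ?_⟩
    · intro I hI I' hI' hne
      obtain ⟨⟨κ, c⟩, hq, rfl⟩ := Finset.mem_image.1 (Finset.mem_filter.1 hI).1
      obtain ⟨⟨κ', c'⟩, hq', rfl⟩ := Finset.mem_image.1 (Finset.mem_filter.1 hI').1
      refine Set.disjoint_left.2 fun z hz hz' => hne ?_
      obtain ⟨rfl, rfl⟩ := huniq κ (Finset.mem_product.1 hq).1 κ' (Finset.mem_product.1 hq').1 c c' z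
        (fun i => hz i trivial) (fun i => hz' i trivial)
      rfl
    · rw [← hJ]
      ext z
      simp only [Set.mem_iUnion, exists_prop]
      constructor
      · rintro ⟨I, hI, hz⟩
        obtain ⟨⟨κ, c⟩, hq, rfl⟩ := Finset.mem_image.1 (Finset.mem_filter.1 hI).1
        have hκ := (Finset.mem_product.1 hq).1
        exact ⟨κ, hκ, fun i _ =>
          nodes_subset (h1 κ hκ i) (h2 κ hκ i) (h3 κ hκ i) _ (hz i trivial)⟩
      · rintro ⟨κ, hκ, hz⟩
        choose c hc using fun i => exists_mem_nodes (x := x κ i) (y := y κ i) (hz i trivial)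
        refine ⟨F (κ, c), ?_, fun i _ => hc i⟩
        refine Finset.mem_filter.2 ⟨Finset.mem_image_of_mem _ (by simp [hκ]), fun i => ?_⟩
        exact (hc i).1.trans_lt (hc i).2
  refine le_trans ?_ (le_iSup _ (⟨π, hπ⟩ : {π // IsBoxPartition J π}))
  refine ENNReal.rpow_le_rpow ?_ (by norm_num)
  -- the chosen boxes are the middle ones; the degenerate ones do not contribute
  let S' := S.filter fun κ => ∀ i, x κ i < y κ i
  have hF1 : ∀ κ, F (κ, fun _ => 1) = (x κ, y κ) := fun κ => rfl
  have hinj : Set.InjOn (fun κ => F (κ, fun _ => 1)) (S' : Set K) := by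
    intro κ hκ κ' hκ' heq
    have hκ := Finset.mem_filter.1 hκ
    have hκ' := Finset.mem_filter.1 hκ'
    have heq : F (κ, fun _ => 1) = F (κ', fun _ => 1) := heq
    refine (huniq κ hκ.1 κ' hκ'.1 (fun _ => 1) (fun _ => 1) (x κ) ?_ ?_).1
    · exact fun i => ⟨le_rfl, hκ.2 i⟩
    · rw [← heq]
      exact fun i => ⟨le_rfl, hκ.2 i⟩
  calc _ = ∑ κ ∈ S', ENNReal.ofReal ((∏ i, (y κ i - x κ i)) *
      |altSum f (x κ) (y κ) / (∏ i, (y κ i - x κ i)) ^ α| ^ 2) := by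
        refine (Finset.sum_subset (Finset.filter_subset _ _) fun κ hκ hκ' => ?_).symm
        have : ∃ i, ¬ x κ i < y κ i := by
          by_contra hcon
          push Not at hcon
          exact hκ' (Finset.mem_filter.2 ⟨hκ, hcon⟩)
        obtain ⟨i, hi⟩ := this
        rw [Finset.prod_eq_zero (Finset.mem_univ i) (by linarith [h2 κ hκ i]), zero_mul,
          ENNReal.ofReal_zero]
    _ = ∑ I ∈ S'.image (fun κ => F (κ, fun _ => 1)), ENNReal.ofReal ((∏ i, (I.2 i - I.1 i)) *
      |altSum f I.1 I.2 / (∏ i, (I.2 i - I.1 i)) ^ α| ^ 2) := by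
        rw [Finset.sum_image hinj]
        simp only [hF1]
    _ ≤ _ := by
        refine Finset.sum_le_sum_of_subset fun I hI => ?_
        obtain ⟨κ, hκ, rfl⟩ := Finset.mem_image.1 hI
        have hκ := Finset.mem_filter.1 hκ
        exact Finset.mem_filter.2 ⟨Finset.mem_image_of_mem _ (by simp [hκ.1]), hκ.2⟩

/-- If boxes of volume at most `U` are chosen in the members of a finite partition of `J`, then
the squares of the corresponding alternating sums add up to at most `U^{2α-1}` times the square of
the variation: smaller boxes have a larger weight `Vol^{1-2α}`. -/
lemma sum_sq_altSum_le {α W U : ℝ} (hα : 1 / 2 < α) (hW : 0 ≤ W) (hU : 0 < U) (J : Set (ι → ℝ))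
    (f : (ι → ℝ) → ℝ) (hf : vitaliVar α J f ≤ ENNReal.ofReal W) (S : Finset K)
    (P Q a c : K → ι → ℝ) (ha : ∀ κ ∈ S, ∀ i, a κ i ∈ Set.Ico (P κ i) (Q κ i))
    (hc : ∀ κ ∈ S, ∀ i, c κ i ∈ Set.Ico (P κ i) (Q κ i))
    (hdisj : (S : Set K).PairwiseDisjoint fun κ => Set.univ.pi fun i => Set.Ico (P κ i) (Q κ i))
    (hJ : (⋃ κ ∈ S, Set.univ.pi fun i => Set.Ico (P κ i) (Q κ i)) = J)
    (hvol : ∀ κ ∈ S, ∏ i, |a κ i - c κ i| ≤ U) :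
    ∑ κ ∈ S, altSum f (a κ) (c κ) ^ 2 ≤ U ^ (2 * α - 1) * W ^ 2 := by
  have hsup : ∀ κ i, (a κ ⊔ c κ) i - (a κ ⊓ c κ) i = |a κ i - c κ i| := fun κ i => by
    rw [Pi.sup_apply, Pi.inf_apply]; exact max_sub_min_eq_abs' _ _
  have main := (sum_altSum_le_vitaliVar α J f S P Q (fun κ => a κ ⊓ c κ) (fun κ => a κ ⊔ c κ)
    (fun κ hκ i => le_min (ha κ hκ i).1 (hc κ hκ i).1)
    (fun κ hκ i => by simp)
    (fun κ hκ i => max_le (ha κ hκ i).2.le (hc κ hκ i).2.le) hdisj hJ).trans hf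
  simp only [hsup] at main
  replace main := ENNReal.rpow_le_rpow main (zero_le_two (α := ℝ))
  rw [← ENNReal.ofReal_sum_of_nonneg (fun κ _ => by positivity), ← ENNReal.rpow_mul,
    one_div, inv_mul_cancel₀ two_ne_zero, ENNReal.rpow_one, ENNReal.rpow_two,
    ← ENNReal.ofReal_pow hW, ENNReal.ofReal_le_ofReal_iff (by positivity)] at main
  have hpos : 0 < U ^ (2 * α - 1) := Real.rpow_pos_of_pos hU _
  refine le_trans ?_ (mul_le_mul_of_nonneg_left main hpos.le)
  rw [Finset.mul_sum]
  refine Finset.sum_le_sum fun κ hκ => ?_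
  rw [← sq_abs, ← abs_altSum_inf_sup, abs_div, div_pow]
  set T := |altSum f (a κ ⊓ c κ) (a κ ⊔ c κ)| with hT
  rcases (Finset.prod_nonneg fun i _ => abs_nonneg (a κ i - c κ i) :
    0 ≤ ∏ i, |a κ i - c κ i|).eq_or_lt with h0 | h0
  · obtain ⟨i, -, hi⟩ := Finset.prod_eq_zero_iff.1 h0.symm
    have : T = 0 := by
      rw [hT, abs_altSum_inf_sup, altSum_eq_zero_of_eq f _ _ i (by linarith [abs_eq_zero.1 hi]),
        abs_zero]
    rw [this]
    simp
  · set w := ∏ i, |a κ i - c κ i|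
    rw [abs_of_pos (Real.rpow_pos_of_pos h0 α)]
    have hw : w * (T ^ 2 / (w ^ α) ^ 2) = w ^ (-(2 * α - 1)) * T ^ 2 := by
      have : w ^ (-(2 * α - 1)) = w / (w ^ α) ^ 2 := by
        rw [← Real.rpow_natCast (w ^ α) 2, ← Real.rpow_mul h0.le, eq_div_iff (by positivity),
          ← Real.rpow_add h0]
        conv_rhs => rw [← Real.rpow_one w]
        congr 1; push_cast; ring
      rw [this]; ring
    rw [hw, ← mul_assoc]
    refine le_mul_of_one_le_left (by positivity) ?_
    rw [Real.rpow_neg h0.le, ← div_eq_mul_inv, one_le_div (Real.rpow_pos_of_pos h0 _)]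
    exact Real.rpow_le_rpow h0.le (hvol κ hκ) (by linarith)

end

/-! ### Mixing the digits of two points -/

/-- For `x` and `τ` in the same interval of length `b^j`: the number that has the first `a` base
`b` digits (relative to that interval) of `x` and the remaining digits of `τ`. The value `none`
stands for the level `a = ∞`, where all digits are those of `x`. -/
noncomputable def mixDigits (b : ℕ) (j : ℤ) (x τ : ℝ) : Option ℕ → ℝ
  | none => x
  | some a => τ + (b : ℝ) ^ (j - a) * (⌊x / (b : ℝ) ^ (j - a)⌋ - ⌊τ / (b : ℝ) ^ (j - a)⌋)

section
variable {b : ℕ} {j : ℤ} {x τ : ℝ}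

lemma mixDigits_zero (h : ⌊x / (b : ℝ) ^ j⌋ = ⌊τ / (b : ℝ) ^ j⌋) :
    mixDigits b j x τ (some 0) = τ := by
  simp [mixDigits, h]

lemma floor_mixDigits_self (hb : 0 < b) (a : ℕ) :
    ⌊mixDigits b j x τ (some a) / (b : ℝ) ^ (j - a)⌋ = ⌊x / (b : ℝ) ^ (j - a)⌋ := by
  have hg : (0 : ℝ) < (b : ℝ) ^ (j - a) := by positivity
  rw [mixDigits, add_div, mul_div_cancel_left₀ _ hg.ne', ← Int.cast_sub, Int.floor_add_intCast]
  ring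

lemma floor_mixDigits (hb : 0 < b) {c a : ℕ} (hca : c ≤ a) :
    ⌊mixDigits b j x τ (some a) / (b : ℝ) ^ (j - c)⌋ = ⌊x / (b : ℝ) ^ (j - c)⌋ := by
  have : j - (c : ℤ) - ((a - c : ℕ) : ℤ) = j - a := by omega
  rw [floor_div_zpow_sub hb _ (a - c), floor_div_zpow_sub hb _ (a - c) x, this,
    floor_mixDigits_self hb]

lemma abs_mixDigits_succ_sub (hb : 0 < b) (a : ℕ) :
    |mixDigits b j x τ (some (a + 1)) - mixDigits b j x τ (some a)| ≤
      (b : ℝ) ^ (j - a) * (((b : ℝ) - 1) / b) := by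
  have hb' : (b : ℝ) ≠ 0 := by positivity
  have hj : j - ((a + 1 : ℕ) : ℤ) = j - a - ((1 : ℕ) : ℤ) := by push_cast; ring
  rw [mixDigits, mixDigits, floor_div_zpow_sub hb (j - a) 1 x, floor_div_zpow_sub hb (j - a) 1 τ,
    ← hj, pow_one]
  set X := ⌊x / (b : ℝ) ^ (j - ((a + 1 : ℕ) : ℤ))⌋
  set T := ⌊τ / (b : ℝ) ^ (j - ((a + 1 : ℕ) : ℤ))⌋
  have hpow : (b : ℝ) ^ (j - (a : ℤ)) = b * (b : ℝ) ^ (j - ((a + 1 : ℕ) : ℤ)) := by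
    rw [hj, zpow_sub₀ hb' (j - a), Nat.cast_one, zpow_one]; field_simp
  have hg : (0 : ℝ) < (b : ℝ) ^ (j - ((a + 1 : ℕ) : ℤ)) := by positivity
  rw [hpow]
  set g := (b : ℝ) ^ (j - ((a + 1 : ℕ) : ℤ))
  -- the difference is `g` times the difference of the digits number `a + 1` of `x` and `τ`
  have hX : (X : ℝ) = b * ((X / (b : ℤ) : ℤ) : ℝ) + ((X % (b : ℤ) : ℤ) : ℝ) := by
    exact_mod_cast (Int.mul_ediv_add_emod X b).symm
  have hT : (T : ℝ) = b * ((T / (b : ℤ) : ℤ) : ℝ) + ((T % (b : ℤ) : ℤ) : ℝ) := by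
    exact_mod_cast (Int.mul_ediv_add_emod T b).symm
  have h1 : τ + g * ((X : ℝ) - T) - (τ + b * g * (((X / (b : ℤ) : ℤ) : ℝ) - ((T / (b : ℤ) : ℤ) : ℝ)))
      = g * (((X % (b : ℤ) - T % (b : ℤ) : ℤ)) : ℝ) := by
    push_cast
    rw [hX, hT]
    ring_nf
  rw [h1, abs_mul, abs_of_pos hg]
  have h2 : |X % (b : ℤ) - T % (b : ℤ)| ≤ (b : ℤ) - 1 := by
    have hbz : (0 : ℤ) < b := by exact_mod_cast hb
    have := Int.emod_nonneg X hbz.ne'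
    have := Int.emod_nonneg T hbz.ne'
    have := Int.emod_lt_of_pos X hbz
    have := Int.emod_lt_of_pos T hbz
    rw [abs_le]; omega
  have h3 : |((X % (b : ℤ) - T % (b : ℤ) : ℤ) : ℝ)| ≤ (b : ℝ) - 1 := by exact_mod_cast h2
  calc g * |((X % (b : ℤ) - T % (b : ℤ) : ℤ) : ℝ)| ≤ g * ((b : ℝ) - 1) := by gcongr
    _ = _ := by field_simp

lemma abs_sub_mixDigits_le (hb : 0 < b) (a : ℕ) :
    |mixDigits b j x τ none - mixDigits b j x τ (some a)| ≤ (b : ℝ) ^ (j - a) := by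
  have hg : (0 : ℝ) < (b : ℝ) ^ (j - a) := by positivity
  have h := Int.abs_sub_lt_one_of_floor_eq_floor
    (floor_mixDigits (j := j) (x := x) (τ := τ) hb (le_refl a)).symm
  rw [← sub_div, abs_div, abs_of_pos hg, div_lt_one hg] at h
  exact h.le

lemma measurable_mixDigits (b : ℕ) (j : ℤ) (x : ℝ) (a : Option ℕ) :
    Measurable fun τ => mixDigits b j x τ a := by
  cases a with
  | none => exact measurable_const
  | some a =>
    simp only [mixDigits]
    have : Measurable fun τ : ℝ => ((⌊τ / (b : ℝ) ^ (j - (a : ℤ))⌋ : ℤ) : ℝ) :=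
      measurable_from_top.comp (Int.measurable_floor.comp (measurable_id.div_const _))
    exact measurable_id.add ((measurable_const.sub this).const_mul _)

end

section
variable {ι : Type*}

/-- The coordinatewise version of `mixDigits` in the box with code `p`, the number of digits taken
from `x` being `a i` in direction `i`. -/
noncomputable def mixPoint (b : ℕ) (p : ι → ℤ × ℤ) (x τ : ι → ℝ) (a : ι → Option ℕ) : ι → ℝ :=
  fun i => mixDigits b (p i).1 (x i) (τ i) (a i)

lemma measurable_mixPoint (b : ℕ) (p : ι → ℤ × ℤ) (x : ι → ℝ) (a : ι → Option ℕ) :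
    Measurable fun τ => mixPoint b p x τ a :=
  measurable_pi_lambda _ fun i => (measurable_mixDigits b _ _ _).comp (measurable_pi_apply i)

lemma cellIndex_mixPoint {b : ℕ} (hb : 0 < b) (p : ι → ℤ × ℤ) (x τ : ι → ℝ) (c : ι → ℕ)
    (a : ι → Option ℕ) (h : ∀ i, ∀ k, a i = some k → c i ≤ k) :
    cellIndex b p c (mixPoint b p x τ a) = cellIndex b p c x := by
  ext i
  rcases hi : a i with _ | k
  · simp [cellIndex, mixPoint, hi, mixDigits]
  · simp only [cellIndex, mixPoint, hi]
    exact floor_mixDigits hb (h i k hi)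

lemma mem_box_iff_cellIndex {b : ℕ} (hb : 0 < b) (p : ι → ℤ × ℤ) (x : ι → ℝ) :
    x ∈ box b p ↔ cellIndex b p (fun _ => 0) x = fun i => (p i).2 := by
  rw [mem_box_iff hb, funext_iff]
  simp [cellIndex]

lemma mixPoint_mem_box {b : ℕ} (hb : 0 < b) {p : ι → ℤ × ℤ} {x τ : ι → ℝ} (hx : x ∈ box b p)
    (a : ι → Option ℕ) : mixPoint b p x τ a ∈ box b p := by
  rw [mem_box_iff_cellIndex hb] at hx ⊢
  rw [cellIndex_mixPoint hb _ _ _ _ _ fun _ _ _ => Nat.zero_le _, hx]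

end

/-! ### Equidistributed points in a box -/

section
variable {ι : Type*} [Fintype ι] [DecidableEq ι] {N : Type*}

/-- The points `x n`, `n ∈ A`, of the box with code `p` are equidistributed up to the resolution
`M`: for all levels `a` with `∑ a_i ≤ M` the cells of level `a` contain equally many points. -/
def IsLocalNet (b : ℕ) (p : ι → ℤ × ℤ) (M : ℕ) (A : Finset N) (x : N → ι → ℝ) : Prop :=
  (∀ n ∈ A, x n ∈ box b p) ∧ ∀ a : ι → ℕ, ∑ i, a i ≤ M → ∀ κ ∈ cellIndices b p a,
    (A.filter fun n => cellIndex b p a (x n) = κ).card * b ^ ∑ i, a i = A.card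

omit [DecidableEq ι] in
lemma integrableOn_comp_mixPoint {b : ℕ} (hb : 0 < b) {p : ι → ℤ × ℤ} {g : (ι → ℝ) → ℝ}
    (hg : Measurable g) {c : ℝ} (hc : ∀ z ∈ box b p, |g z| ≤ c) {x : ι → ℝ} (hx : x ∈ box b p)
    (a : ι → Option ℕ) : IntegrableOn (fun τ => g (mixPoint b p x τ a)) (box b p) :=
  IntegrableOn.of_bound (volume_box_lt_top b p)
    (hg.comp (measurable_mixPoint b p x a)).aestronglyMeasurable c
    (Filter.Eventually.of_forall fun _ => hc _ (mixPoint_mem_box hb hx a))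

/-- Averaging over `τ` averages `g` over the cell of `x`. -/
lemma integral_comp_mixPoint {b : ℕ} (hb : 0 < b) {p : ι → ℤ × ℤ} {g : (ι → ℝ) → ℝ}
    (hg : Measurable g) {c : ℝ} (hc : ∀ z ∈ box b p, |g z| ≤ c) {x : ι → ℝ} (hx : x ∈ box b p)
    (a : ι → ℕ) :
    ∫ τ in box b p, g (mixPoint b p x τ fun i => some (a i)) =
      (b : ℝ) ^ (∑ i, a i) * ∫ z in box b (cell p a (cellIndex b p a x)), g z := by
  have hint := integrableOn_comp_mixPoint hb hg hc hx fun i => some (a i)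
  rw [box_eq_biUnion_cell hb p a] at hint ⊢
  rw [integral_biUnion_finset _ (fun κ _ => measurableSet_box _ _) (pairwiseDisjoint_cell hb p a _)
    (fun κ hκ => hint.mono_set (Set.subset_biUnion_of_mem (u := fun κ => box b (cell p a κ)) hκ))]
  rw [Finset.sum_congr rfl (g := fun _ => ∫ z in box b (cell p a (cellIndex b p a x)), g z),
    Finset.sum_const, card_cellIndices]
  · simp
  intro κ _
  -- on a cell, mixing digits is a translation onto the cell of `x`
  let w : ι → ℝ := fun i => (b : ℝ) ^ ((p i).1 - (a i : ℤ)) * ((cellIndex b p a x i : ℝ) - κ i)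
  have hpre : box b (cell p a κ) = (fun τ => τ + w) ⁻¹' box b (cell p a (cellIndex b p a x)) := by
    ext τ
    rw [Set.mem_preimage, mem_box_cell_iff hb, mem_box_cell_iff hb, funext_iff, funext_iff]
    refine forall_congr' fun i => ?_
    have hgi : (0 : ℝ) < (b : ℝ) ^ ((p i).1 - (a i : ℤ)) := by positivity
    have : cellIndex b p a (τ + w) i = cellIndex b p a τ i + (cellIndex b p a x i - κ i) := by
      rw [cellIndex, Pi.add_apply, add_div, mul_div_cancel_left₀ _ hgi.ne', ← Int.cast_sub,
        Int.floor_add_intCast]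
      rfl
    rw [this]
    omega
  have hcongr : ∫ τ in box b (cell p a κ), g (mixPoint b p x τ fun i => some (a i)) =
      ∫ τ in box b (cell p a κ), g (τ + w) := by
    refine setIntegral_congr_fun (measurableSet_box _ _) fun τ hτ => ?_
    rw [mem_box_cell_iff hb] at hτ
    subst hτ
    rfl
  rw [hcongr, hpre]
  exact (measurePreserving_add_right volume w).setIntegral_preimage_emb
    (measurableEmbedding_addRight w) g _

lemma IsLocalNet.sum_integral_comp_mixPoint {b : ℕ} (hb : 0 < b) {p : ι → ℤ × ℤ} {M : ℕ}
    {A : Finset N} {x : N → ι → ℝ} (hx : IsLocalNet b p M A x) {g : (ι → ℝ) → ℝ}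
    (hg : Measurable g) {c : ℝ} (hc : ∀ z ∈ box b p, |g z| ≤ c) (a : ι → ℕ) (ha : ∑ i, a i ≤ M) :
    ∑ n ∈ A, ∫ τ in box b p, g (mixPoint b p (x n) τ fun i => some (a i)) =
      A.card * ∫ z in box b p, g z := by
  have hint : IntegrableOn g (box b p) := IntegrableOn.of_bound (volume_box_lt_top b p)
    hg.aestronglyMeasurable c ((ae_restrict_iff' (measurableSet_box b p)).2
      (Filter.Eventually.of_forall hc))
  rw [Finset.sum_congr rfl fun n hn => integral_comp_mixPoint hb hg hc (hx.1 n hn) a]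
  rw [← Finset.sum_fiberwise_of_maps_to (t := cellIndices b p a)
    (g := fun n => cellIndex b p a (x n))
    (fun n hn => (floor_mem_cellIndices_iff hb p a _).2 (hx.1 n hn))]
  rw [box_eq_biUnion_cell hb p a] at hint ⊢
  rw [integral_biUnion_finset _ (fun κ _ => measurableSet_box _ _) (pairwiseDisjoint_cell hb p a _)
    (fun κ hκ => hint.mono_set (Set.subset_biUnion_of_mem (u := fun κ => box b (cell p a κ)) hκ)),
    Finset.mul_sum]
  refine Finset.sum_congr rfl fun κ hκ => ?_
  rw [Finset.sum_congr rfl (g := fun _ => (b : ℝ) ^ (∑ i, a i) * ∫ z in box b (cell p a κ), g z)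
    fun n hn => by rw [(Finset.mem_filter.1 hn).2], Finset.sum_const, nsmul_eq_mul, ← mul_assoc,
    ← hx.2 a ha κ hκ]
  push_cast
  ring

end

/-! ### Alternating sums between levels -/

section
variable {ι : Type*} [Fintype ι] [DecidableEq ι] {N : Type*}

/-- Alternating sums between two levels, one term for each point of a local net. All boxes that
belong to points of the same cell of level `lo` lie in that cell; so one box for each cell is
chosen, and the variation controls the sum over the chosen boxes. -/
lemma IsLocalNet.sum_abs_altSum_le {b : ℕ} (hb : 0 < b) {p : ι → ℤ × ℤ} {M : ℕ}
    {A : Finset N} {x : N → ι → ℝ} (hx : IsLocalNet b p M A x) {g : (ι → ℝ) → ℝ}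
    {α W U : ℝ} (hα : 1 / 2 < α) (hW : 0 ≤ W) (hU : 0 < U)
    (hg : vitaliVar α (box b p) g ≤ ENNReal.ofReal W) (lo : ι → ℕ) (hi : ι → Option ℕ)
    (hlo : ∑ i, lo i ≤ M) (hle : ∀ i k, hi i = some k → lo i ≤ k) (τ : ι → ℝ)
    (hvol : ∀ n ∈ A, ∏ i, |mixPoint b p (x n) τ hi i -
      mixPoint b p (x n) τ (fun i => some (lo i)) i| ≤ U) :
    ∑ n ∈ A, |altSum g (mixPoint b p (x n) τ hi) (mixPoint b p (x n) τ fun i => some (lo i))| ≤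
      A.card * ((b : ℝ) ^ (-((∑ i, lo i : ℕ) : ℝ) / 2) * U ^ (α - 1 / 2) * W) := by
  have hbR : (0 : ℝ) < b := by exact_mod_cast hb
  rcases A.eq_empty_or_nonempty with rfl | hA
  · simp
  have : Nonempty N := ⟨hA.choose⟩
  set L := ∑ i, lo i
  set K := cellIndices b p lo
  set T : N → ℝ := fun n =>
    altSum g (mixPoint b p (x n) τ hi) (mixPoint b p (x n) τ fun i => some (lo i)) with hT
  have hcount := hx.2 lo hlo
  have hex : ∀ κ ∈ K, ∃ n ∈ A, cellIndex b p lo (x n) = κ ∧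
      ∀ n' ∈ A, cellIndex b p lo (x n') = κ → |T n'| ≤ |T n| := by
    intro κ hκ
    have hne : (A.filter fun n => cellIndex b p lo (x n) = κ).Nonempty := by
      rw [← Finset.card_pos]
      refine Nat.pos_of_ne_zero fun h0 => hA.card_pos.ne' ?_
      rw [← hcount κ hκ, h0, zero_mul]
    obtain ⟨n, hn, hmax⟩ := Finset.exists_max_image _ (fun n => |T n|) hne
    rw [Finset.mem_filter] at hn
    exact ⟨n, hn.1, hn.2, fun n' hn' h' => hmax n' (Finset.mem_filter.2 ⟨hn', h'⟩)⟩
  choose! ν hνA hνκ hνmax using hex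
  have hmaps : ∀ n ∈ A, cellIndex b p lo (x n) ∈ K := fun n hn =>
    (floor_mem_cellIndices_iff hb p lo _).2 (hx.1 n hn)
  -- replace every point by the chosen point of its cell
  have h1 : (b : ℝ) ^ L * ∑ n ∈ A, |T n| ≤ A.card * ∑ κ ∈ K, |T (ν κ)| := by
    calc (b : ℝ) ^ L * ∑ n ∈ A, |T n|
        ≤ (b : ℝ) ^ L * ∑ n ∈ A, |T (ν (cellIndex b p lo (x n)))| := by
          refine mul_le_mul_of_nonneg_left (Finset.sum_le_sum fun n hn => ?_) (by positivity)
          exact hνmax _ (hmaps n hn) n hn rfl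
      _ = _ := by
          rw [← Finset.sum_fiberwise_of_maps_to (t := K) hmaps, Finset.mul_sum, Finset.mul_sum]
          refine Finset.sum_congr rfl fun κ hκ => ?_
          rw [Finset.sum_congr rfl (g := fun _ => |T (ν κ)|)
            fun n hn => by rw [(Finset.mem_filter.1 hn).2], Finset.sum_const, nsmul_eq_mul,
            ← mul_assoc, ← hcount κ hκ]
          push_cast
          ring
  -- the chosen boxes are disjoint
  have h2 : ∑ κ ∈ K, T (ν κ) ^ 2 ≤ U ^ (2 * α - 1) * W ^ 2 := by
    have hcellmem : ∀ κ ∈ K, ∀ a : ι → Option ℕ, (∀ i k, a i = some k → lo i ≤ k) → ∀ i,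
        mixPoint b p (x (ν κ)) τ a i ∈ interval b (cell p lo κ i) := by
      intro κ hκ a ha
      have : mixPoint b p (x (ν κ)) τ a ∈ box b (cell p lo κ) := by
        rw [mem_box_cell_iff hb, cellIndex_mixPoint hb _ _ _ _ _ ha, hνκ κ hκ]
      exact this
    refine sum_sq_altSum_le hα hW hU (box b p) g hg K
      (fun κ i => (b : ℝ) ^ (cell p lo κ i).1 * (cell p lo κ i).2)
      (fun κ i => (b : ℝ) ^ (cell p lo κ i).1 * ((cell p lo κ i).2 + 1))
      (fun κ => mixPoint b p (x (ν κ)) τ hi)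
      (fun κ => mixPoint b p (x (ν κ)) τ fun i => some (lo i))
      (fun κ hκ => hcellmem κ hκ hi hle)
      (fun κ hκ => hcellmem κ hκ _ fun i k h => (Option.some.inj h).le) ?_ ?_
      (fun κ hκ => hvol _ (hνA κ hκ))
    · simpa only [box_eq_pi_Ico] using pairwiseDisjoint_cell hb p lo (K : Set (ι → ℤ))
    · simpa only [box_eq_pi_Ico] using (box_eq_biUnion_cell hb p lo).symm
  have h3 : (∑ κ ∈ K, |T (ν κ)|) ≤ (b : ℝ) ^ ((L : ℝ) / 2) * U ^ (α - 1 / 2) * W := by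
    refine le_of_sq_le_sq ?_ (by positivity)
    calc (∑ κ ∈ K, |T (ν κ)|) ^ 2 ≤ K.card * ∑ κ ∈ K, |T (ν κ)| ^ 2 := sq_sum_le_card_mul_sum_sq
      _ = (b : ℝ) ^ L * ∑ κ ∈ K, T (ν κ) ^ 2 := by
          rw [card_cellIndices]; simp only [sq_abs]; push_cast; rfl
      _ ≤ (b : ℝ) ^ L * (U ^ (2 * α - 1) * W ^ 2) := by gcongr
      _ = _ := by
          rw [mul_pow, mul_pow, ← Real.rpow_natCast (_ ^ ((L : ℝ) / 2)) 2,
            ← Real.rpow_natCast (U ^ _) 2, ← Real.rpow_mul hbR.le, ← Real.rpow_mul hU.le,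
            ← Real.rpow_natCast]
          push_cast
          ring_nf
  have h4 : ∑ n ∈ A, |T n| ≤ ((b : ℝ) ^ L)⁻¹ * (A.card * ∑ κ ∈ K, |T (ν κ)|) := by
    rw [le_inv_mul_iff₀ (by positivity)]; exact h1
  refine h4.trans ?_
  calc ((b : ℝ) ^ L)⁻¹ * (A.card * ∑ κ ∈ K, |T (ν κ)|)
      ≤ ((b : ℝ) ^ L)⁻¹ * (A.card * ((b : ℝ) ^ ((L : ℝ) / 2) * U ^ (α - 1 / 2) * W)) := by gcongr
    _ = _ := by
      have : (b : ℝ) ^ (-(L : ℝ) / 2) = ((b : ℝ) ^ L)⁻¹ * (b : ℝ) ^ ((L : ℝ) / 2) := by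
        rw [← Real.rpow_natCast, ← Real.rpow_neg hbR.le, ← Real.rpow_add hbR]
        congr 1; ring
      rw [this]; ring

/-- The sum over the points of the mean over `τ` of the alternating sum between the levels
`lo` and `hi`. -/
noncomputable def levelSum (b : ℕ) (p : ι → ℤ × ℤ) (A : Finset N) (x : N → ι → ℝ)
    (g : (ι → ℝ) → ℝ) (lo : ι → ℕ) (hi : ι → Option ℕ) : ℝ :=
  ∑ n ∈ A, ∫ τ in box b p,
    altSum g (mixPoint b p (x n) τ hi) (mixPoint b p (x n) τ fun i => some (lo i))

omit [Fintype ι] in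
lemma mixPoint_ite {b : ℕ} (p : ι → ℤ × ℤ) (x τ : ι → ℝ) (a a' : ι → Option ℕ) (v : Finset ι) :
    (fun i => if i ∈ v then mixPoint b p x τ a' i else mixPoint b p x τ a i) =
      mixPoint b p x τ fun i => if i ∈ v then a' i else a i := by
  ext i; by_cases h : i ∈ v <;> simp [mixPoint, h]

omit [Fintype ι] in
lemma mixPoint_update {b : ℕ} (p : ι → ℤ × ℤ) (x τ : ι → ℝ) (a : ι → Option ℕ) (i : ι)
    (c : Option ℕ) :
    mixPoint b p x τ (Function.update a i c) =
      Function.update (mixPoint b p x τ a) i (mixDigits b (p i).1 (x i) (τ i) c) := by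
  ext k
  by_cases hk : k = i
  · subst hk; simp [mixPoint]
  · simp [mixPoint, hk]

lemma integrableOn_altSum_mixPoint {b : ℕ} (hb : 0 < b) {p : ι → ℤ × ℤ} {g : (ι → ℝ) → ℝ}
    (hg : Measurable g) {c : ℝ} (hc : ∀ z ∈ box b p, |g z| ≤ c) {x : ι → ℝ} (hx : x ∈ box b p)
    (a a' : ι → Option ℕ) :
    IntegrableOn (fun τ => altSum g (mixPoint b p x τ a) (mixPoint b p x τ a')) (box b p) := by
  simp only [altSum, mixPoint_ite]
  exact integrable_finsetSum _ fun v _ =>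
    (integrableOn_comp_mixPoint hb hg hc hx _).const_mul _

/-- Splitting the range of levels in one direction. -/
lemma levelSum_update_add {b : ℕ} (hb : 0 < b) {p : ι → ℤ × ℤ}
    {A : Finset N} {x : N → ι → ℝ} (hx : ∀ n ∈ A, x n ∈ box b p) {g : (ι → ℝ) → ℝ}
    (hg : Measurable g) {c : ℝ} (hc : ∀ z ∈ box b p, |g z| ≤ c) (lo : ι → ℕ) (hi : ι → Option ℕ)
    (i : ι) (u v : ℕ) (w : Option ℕ) :
    levelSum b p A x g (Function.update lo i u) (Function.update hi i w) =
      levelSum b p A x g (Function.update lo i u) (Function.update hi i (some v)) +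
      levelSum b p A x g (Function.update lo i v) (Function.update hi i w) := by
  rw [levelSum, levelSum, levelSum, ← Finset.sum_add_distrib]
  refine Finset.sum_congr rfl fun n hn => ?_
  rw [← integral_add (integrableOn_altSum_mixPoint hb hg hc (hx n hn) _ _)
    (integrableOn_altSum_mixPoint hb hg hc (hx n hn) _ _)]
  congr 1
  ext τ
  have hup : ∀ k, (fun j => some (Function.update lo i k j)) =
      Function.update (fun j => some (lo j)) i (some k) := by
    intro k; ext1 j
    by_cases hj : j = i
    · subst hj; simp
    · simp [hj]
  simp only [hup, mixPoint_update]
  rw [altSum_update_add g _ _ i _ (mixDigits b (p i).1 (x n i) (τ i) (some v)), add_comm]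

/-- Splitting the infinite range of levels in one direction after the first `L` steps. -/
lemma levelSum_update_telescope {b : ℕ} (hb : 0 < b) {p : ι → ℤ × ℤ}
    {A : Finset N} {x : N → ι → ℝ} (hx : ∀ n ∈ A, x n ∈ box b p) {g : (ι → ℝ) → ℝ}
    (hg : Measurable g) {c : ℝ} (hc : ∀ z ∈ box b p, |g z| ≤ c) (lo : ι → ℕ) (hi : ι → Option ℕ)
    (i : ι) (L : ℕ) :
    levelSum b p A x g (Function.update lo i 0) (Function.update hi i none) =
      ∑ a ∈ Finset.range L,
        levelSum b p A x g (Function.update lo i a) (Function.update hi i (some (a + 1))) +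
      levelSum b p A x g (Function.update lo i L) (Function.update hi i none) := by
  induction L with
  | zero => simp
  | succ L ih =>
    rw [ih, levelSum_update_add hb hx hg hc lo hi i L (L + 1) none, Finset.sum_range_succ]
    ring

/-- Levels that are resolved by the point set do not contribute to the error. -/
lemma IsLocalNet.levelSum_eq_zero [Nonempty ι] {b : ℕ} (hb : 0 < b) {p : ι → ℤ × ℤ} {M : ℕ}
    {A : Finset N} {x : N → ι → ℝ} (hx : IsLocalNet b p M A x) {g : (ι → ℝ) → ℝ}
    (hg : Measurable g) {c : ℝ} (hc : ∀ z ∈ box b p, |g z| ≤ c) (lo : ι → ℕ)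
    (hM : ∑ i, (lo i + 1) ≤ M) :
    levelSum b p A x g lo (fun i => some (lo i + 1)) = 0 := by
  have hterm : ∀ v : Finset ι, ∑ n ∈ A, ∫ τ in box b p, g (mixPoint b p (x n) τ
      fun i => if i ∈ v then some (lo i) else some (lo i + 1)) = A.card * ∫ z in box b p, g z := by
    intro v
    rw [← hx.sum_integral_comp_mixPoint hb hg hc (fun i => if i ∈ v then lo i else lo i + 1)]
    · refine Finset.sum_congr rfl fun n _ => ?_
      congr 1; ext τ; congr 2; ext1 i
      split_ifs <;> rfl
    · refine (Finset.sum_le_sum fun i _ => ?_).trans hM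
      split_ifs <;> omega
  calc levelSum b p A x g lo (fun i => some (lo i + 1))
      = ∑ n ∈ A, ∑ v : Finset ι, (-1 : ℝ) ^ v.card * ∫ τ in box b p, g (mixPoint b p (x n) τ
          fun i => if i ∈ v then some (lo i) else some (lo i + 1)) := by
        refine Finset.sum_congr rfl fun n hn => ?_
        simp only [altSum, mixPoint_ite]
        rw [integral_finsetSum _ fun v _ =>
          (integrableOn_comp_mixPoint hb hg hc (hx.1 n hn) _).const_mul _]
        simp only [integral_const_mul]
    _ = ∑ v : Finset ι, (-1 : ℝ) ^ v.card * (A.card * ∫ z in box b p, g z) := by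
        rw [Finset.sum_comm]
        refine Finset.sum_congr rfl fun v _ => ?_
        rw [← Finset.mul_sum, hterm]
    _ = 0 := by
        rw [← Finset.sum_mul, ← Finset.powerset_univ]
        have := Finset.sum_powerset_neg_one_pow_card_of_nonempty
          (x := (Finset.univ : Finset ι)) Finset.univ_nonempty
        have h : (∑ v ∈ (Finset.univ : Finset ι).powerset, (-1 : ℝ) ^ v.card) = 0 := by
          exact_mod_cast this
        rw [h, zero_mul]

end

/-! ### The error of a local net in terms of the variation -/

section
variable {ι : Type*} [Fintype ι] [DecidableEq ι] {N : Type*}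

omit [DecidableEq ι] in
lemma volume_real_box (b : ℕ) (p : ι → ℤ × ℤ) :
    volume.real (box b p) = ∏ i, (b : ℝ) ^ (p i).1 := by
  rw [Measure.real, volume_box, ENNReal.toReal_ofReal]
  exact Finset.prod_nonneg fun i _ => by positivity

/-- Terms with an infinite upper level, and with total level as large as the resolution of the
point set allows. In the directions with `hi i = lo i + 1` the two points differ by at most
`(b - 1) / b` times the length of the cell of level `lo i`. -/
lemma IsLocalNet.abs_levelSum_le {b : ℕ} (hb : 2 ≤ b) {p : ι → ℤ × ℤ} {M : ℕ}
    {A : Finset N} {x : N → ι → ℝ} (hx : IsLocalNet b p M A x) {g : (ι → ℝ) → ℝ}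
    (hg : Measurable g) {C : ℝ} (hC : ∀ z ∈ box b p, |g z| ≤ C)
    {α W : ℝ} (hα : 1 / 2 < α) (hW : 0 ≤ W)
    (hvar : vitaliVar α (box b p) g ≤ ENNReal.ofReal W) (lo : ι → ℕ) (hi : ι → Option ℕ)
    (D : Finset ι) (hD : ∀ i ∈ D, hi i = some (lo i + 1)) (hD' : ∀ i ∉ D, hi i = none)
    (hM : ∑ i, lo i + D.card = M) :
    |levelSum b p A x g lo hi| ≤ A.card * ((∏ i, (b : ℝ) ^ (p i).1) ^ (α + 1 / 2) *
      (b : ℝ) ^ (-α * M) * (((b : ℝ) - 1) ^ (α - 1 / 2) * (b : ℝ) ^ (1 / 2 : ℝ)) ^ D.card * W) := by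
  have hb0 : 0 < b := by omega
  have hbR : (0 : ℝ) < b := by exact_mod_cast hb0
  have hb1 : (0 : ℝ) < (b : ℝ) - 1 := by
    have : (2 : ℝ) ≤ b := by exact_mod_cast hb
    linarith
  set v := ∏ i, (b : ℝ) ^ (p i).1 with hv
  have hv0 : 0 < v := Finset.prod_pos fun i _ => by positivity
  set L := ∑ i, lo i with hL
  set U := v * ((b : ℝ) ^ L)⁻¹ * (((b : ℝ) - 1) / b) ^ D.card with hU
  have hU0 : 0 < U := by positivity
  have hvol : ∀ τ, ∀ n ∈ A, ∏ i, |mixPoint b p (x n) τ hi i -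
      mixPoint b p (x n) τ (fun i => some (lo i)) i| ≤ U := by
    intro τ n _
    have : U = ∏ i, ((b : ℝ) ^ ((p i).1 - (lo i : ℤ)) *
        if i ∈ D then ((b : ℝ) - 1) / b else 1) := by
      rw [Finset.prod_mul_distrib, Finset.prod_ite_mem, Finset.univ_inter, Finset.prod_const, hU,
        hv, hL, ← Finset.prod_pow_eq_pow_sum, ← Finset.prod_inv_distrib, ← Finset.prod_mul_distrib]
      congr 1
      refine Finset.prod_congr rfl fun i _ => ?_
      rw [zpow_sub₀ hbR.ne', zpow_natCast, div_eq_mul_inv]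
    rw [this]
    refine Finset.prod_le_prod (fun i _ => abs_nonneg _) fun i _ => ?_
    by_cases h : i ∈ D
    · rw [if_pos h]
      simp only [mixPoint, hD i h]
      exact abs_mixDigits_succ_sub hb0 _
    · rw [if_neg h, mul_one]
      simp only [mixPoint, hD' i h]
      exact abs_sub_mixDigits_le hb0 _
  have hle : ∀ i k, hi i = some k → lo i ≤ k := by
    intro i k hk
    by_cases h : i ∈ D
    · rw [hD i h] at hk
      have := Option.some.inj hk
      omega
    · rw [hD' i h] at hk
      cases hk
  have hbound := norm_setIntegral_le_of_norm_le_const (volume_box_lt_top b p)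
    (f := fun τ => ∑ n ∈ A,
      altSum g (mixPoint b p (x n) τ hi) (mixPoint b p (x n) τ fun i => some (lo i)))
    (C := A.card * ((b : ℝ) ^ (-(L : ℝ) / 2) * U ^ (α - 1 / 2) * W)) fun τ _ => by
      rw [Real.norm_eq_abs]
      exact (Finset.abs_sum_le_sum_abs _ _).trans (hx.sum_abs_altSum_le hb0 hα hW hU0 hvar lo hi
        (by omega) hle τ (hvol τ))
  rw [integral_finsetSum _ fun n hn => integrableOn_altSum_mixPoint hb0 hg hC (hx.1 n hn) _ _,
    Real.norm_eq_abs, volume_real_box] at hbound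
  refine hbound.trans_eq ?_
  have hUpow : U ^ (α - 1 / 2) = v ^ (α - 1 / 2) * (b : ℝ) ^ (-(L : ℝ) * (α - 1 / 2)) *
      ((((b : ℝ) - 1) ^ (α - 1 / 2)) ^ D.card * (b : ℝ) ^ (-(D.card : ℝ) * (α - 1 / 2))) := by
    have e1 : (((b : ℝ) ^ L)⁻¹) ^ (α - 1 / 2) = (b : ℝ) ^ (-(L : ℝ) * (α - 1 / 2)) := by
      rw [← Real.rpow_natCast, ← Real.rpow_neg hbR.le, ← Real.rpow_mul hbR.le]
    have e2 : ((((b : ℝ) - 1) / b) ^ D.card) ^ (α - 1 / 2) =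
        (((b : ℝ) - 1) ^ (α - 1 / 2)) ^ D.card * (b : ℝ) ^ (-(D.card : ℝ) * (α - 1 / 2)) := by
      rw [← Real.rpow_natCast, ← Real.rpow_natCast, ← Real.rpow_mul (by positivity),
        Real.div_rpow hb1.le hbR.le, ← Real.rpow_mul hb1.le, mul_comm (D.card : ℝ), neg_mul,
        Real.rpow_neg hbR.le, div_eq_mul_inv, mul_comm (D.card : ℝ)]
    rw [hU, Real.mul_rpow (by positivity) (by positivity),
      Real.mul_rpow (by positivity) (by positivity), e1, e2]
  have hb3 : (b : ℝ) ^ (-(L : ℝ) / 2) * (b : ℝ) ^ (-(L : ℝ) * (α - 1 / 2)) *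
      (b : ℝ) ^ (-(D.card : ℝ) * (α - 1 / 2)) =
      (b : ℝ) ^ (-α * M) * ((b : ℝ) ^ (1 / 2 : ℝ)) ^ D.card := by
    rw [← Real.rpow_natCast (_ ^ (1 / 2 : ℝ)), ← Real.rpow_mul hbR.le, ← Real.rpow_add hbR,
      ← Real.rpow_add hbR, ← Real.rpow_add hbR, ← hM]
    congr 1
    push_cast
    ring
  have hv3 : v ^ (α + 1 / 2) = v ^ (α - 1 / 2) * v := by
    rw [← Real.rpow_add_one hv0.ne']; congr 1; ring
  rw [hUpow, mul_pow, hv3]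
  calc _ = A.card * ((v ^ (α - 1 / 2) * v) * ((b : ℝ) ^ (-(L : ℝ) / 2) *
      (b : ℝ) ^ (-(L : ℝ) * (α - 1 / 2)) * (b : ℝ) ^ (-(D.card : ℝ) * (α - 1 / 2))) *
      (((b : ℝ) - 1) ^ (α - 1 / 2)) ^ D.card * W) := by ring
    _ = _ := by rw [hb3]; ring

/-- The recursion that bounds the number of products of differences with a tail: in a direction
either an exact level `a + 1 ≤ L` is split off, or the tail is taken. -/
lemma sum_range_choose_add_le (m L : ℕ) :
    ∑ a ∈ Finset.range L, (L - (a + 1) + m).choose m + 1 ≤ (L + (m + 1)).choose (m + 1) := by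
  have h1 : ∑ a ∈ Finset.range L, (L - (a + 1) + m).choose m =
      ∑ a ∈ Finset.range L, (a + m).choose m := by
    rw [← Finset.sum_range_reflect]
    refine Finset.sum_congr rfl fun a ha => ?_
    rw [Finset.mem_range] at ha
    congr 2
    omega
  rw [h1]
  clear h1
  induction L with
  | zero => simp
  | succ L ih =>
    have h2 : (L + m).choose m ≤ (L + m + 1).choose m := Nat.choose_le_choose m (Nat.le_succ _)
    have h3 : (L + 1 + (m + 1)).choose (m + 1) =
        (L + m + 1).choose m + (L + (m + 1)).choose (m + 1) := by
      rw [show L + 1 + (m + 1) = (L + m + 1) + 1 by ring, Nat.choose_succ_succ]; rfl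
    rw [Finset.sum_range_succ, h3]
    omega

/-- The error of a local net in terms of the variation of the integrand. The infinite sum over all
levels in all directions is split one direction at a time: as long as the total level stays within
the resolution of the points, exact levels are split off; the first time it would be exceeded, the
remaining levels are kept together. Each part of the second kind is estimated by the variation, and
they are counted by a binomial coefficient. -/
lemma IsLocalNet.abs_sum_integral_altSum_le [Nonempty ι] {b : ℕ} (hb : 2 ≤ b) {p : ι → ℤ × ℤ}
    {M : ℕ} {A : Finset N} {x : N → ι → ℝ} (hx : IsLocalNet b p M A x) {g : (ι → ℝ) → ℝ}
    (hg : Measurable g) {C : ℝ} (hC : ∀ z ∈ box b p, |g z| ≤ C)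
    {α W : ℝ} (hα : 1 / 2 < α) (hW : 0 ≤ W)
    (hvar : vitaliVar α (box b p) g ≤ ENNReal.ofReal W) :
    |∑ n ∈ A, ∫ τ in box b p, altSum g (x n) τ| ≤
      (M + Fintype.card ι - 1).choose (Fintype.card ι - 1) * (A.card *
        ((∏ i, (b : ℝ) ^ (p i).1) ^ (α + 1 / 2) * (b : ℝ) ^ (-α * M) *
        (((b : ℝ) - 1) ^ (α - 1 / 2) * (b : ℝ) ^ (1 / 2 : ℝ)) ^ (Fintype.card ι - 1) * W)) := by
  have hb0 : 0 < b := by omega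
  have hb2 : (2 : ℝ) ≤ b := by exact_mod_cast hb
  have hb1 : (1 : ℝ) ≤ (b : ℝ) - 1 := by linarith
  have hcc : 1 ≤ ((b : ℝ) - 1) ^ (α - 1 / 2) * (b : ℝ) ^ (1 / 2 : ℝ) :=
    one_le_mul_of_one_le_of_one_le (Real.one_le_rpow hb1 (by linarith))
      (Real.one_le_rpow (by linarith) (by norm_num))
  set cc := ((b : ℝ) - 1) ^ (α - 1 / 2) * (b : ℝ) ^ (1 / 2 : ℝ)
  have hv0 : 0 < ∏ i, (b : ℝ) ^ (p i).1 := Finset.prod_pos fun i _ => by positivity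
  set B := A.card * ((∏ i, (b : ℝ) ^ (p i).1) ^ (α + 1 / 2) * (b : ℝ) ^ (-α * M) *
        cc ^ (Fintype.card ι - 1) * W) with hB
  have hB0 : 0 ≤ B := by positivity
  have key : ∀ T : Finset ι, ∀ (L : ℕ) (lo : ι → ℕ) (hi : ι → Option ℕ),
      (∀ i ∈ T, lo i = 0 ∧ hi i = none) → (∀ i ∉ T, hi i = some (lo i + 1)) →
      ∑ i ∈ Tᶜ, (lo i + 1) + L = M →
      |levelSum b p A x g lo hi| ≤
        (if T = ∅ then 0 else (L + (T.card - 1)).choose (T.card - 1) : ℕ) * B := by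
    intro T
    induction T using Finset.induction_on with
    | empty =>
      intro L lo hi _ h2 h3
      have : hi = fun i => some (lo i + 1) := funext fun i => h2 i (Finset.notMem_empty i)
      rw [this, hx.levelSum_eq_zero hb0 hg hC lo (by
        rw [Finset.compl_empty] at h3
        omega)]
      simp
    | insert r T hr ih =>
      intro L lo hi h1 h2 h3
      have hr1 := h1 r (Finset.mem_insert_self r T)
      have hlo : lo = Function.update lo r 0 := by rw [← hr1.1, Function.update_eq_self]
      have hhi : hi = Function.update hi r none := by rw [← hr1.2, Function.update_eq_self]
      have hcompl : Tᶜ = insert r (insert r T)ᶜ := by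
        ext i; by_cases hi : i = r <;> simp [hi, hr]
      have hrc : r ∉ (insert r T)ᶜ := by simp
      have htel := levelSum_update_telescope hb0 hx.1 hg hC lo hi r L
      rw [← hlo, ← hhi] at htel
      -- an exact level in direction `r`
      have hstep : ∀ a ∈ Finset.range L,
          |levelSum b p A x g (Function.update lo r a) (Function.update hi r (some (a + 1)))| ≤
          (if T = ∅ then 0 else (L - (a + 1) + (T.card - 1)).choose (T.card - 1) : ℕ) * B := by
        intro a ha
        rw [Finset.mem_range] at ha
        refine ih _ _ _ (fun i hi' => ?_) (fun i hi' => ?_) ?_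
        · have : i ≠ r := fun h => hr (h ▸ hi')
          simpa [this] using h1 i (Finset.mem_insert_of_mem hi')
        · by_cases h : i = r
          · subst h; simp
          · simpa [h] using h2 i (by simp [h, hi'])
        · rw [hcompl, Finset.sum_insert hrc, Function.update_self,
            Finset.sum_congr rfl (g := fun i => lo i + 1) fun i hi' => by
              rw [Function.update_of_ne (ne_of_mem_of_not_mem hi' hrc)]]
          omega
      -- all remaining levels in direction `r`
      have hrem : |levelSum b p A x g (Function.update lo r L) hi| ≤ B := by
        have hsum : ∑ i, Function.update lo r L i + ((insert r T)ᶜ).card = M := by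
          rw [← Finset.sum_add_sum_compl (insert r T), Finset.sum_insert hr, Function.update_self,
            Finset.sum_eq_zero (s := T), ← h3, Finset.sum_add_distrib,
            Finset.sum_congr rfl (g := lo) (s₁ := (insert r T)ᶜ) fun i hi' => by
              rw [Function.update_of_ne (ne_of_mem_of_not_mem hi' hrc)]]
          · rw [Finset.sum_const, smul_eq_mul, mul_one]; ring
          · intro i hi'
            have : i ≠ r := fun h => hr (h ▸ hi')
            rw [Function.update_of_ne this]
            exact (h1 i (Finset.mem_insert_of_mem hi')).1
        refine (hx.abs_levelSum_le hb hg hC hα hW hvar _ hi (insert r T)ᶜ (fun i hi' => ?_)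
          (fun i hi' => ?_) hsum).trans ?_
        · have : i ≠ r := fun h => hrc (h ▸ hi')
          rw [Function.update_of_ne this]
          exact h2 i (Finset.mem_compl.1 hi')
        · exact (h1 i (by rwa [Finset.mem_compl, not_not] at hi')).2
        · rw [hB]
          refine mul_le_mul_of_nonneg_left (mul_le_mul_of_nonneg_right (mul_le_mul_of_nonneg_left
            (pow_le_pow_right₀ hcc ?_) (by positivity)) hW) (Nat.cast_nonneg _)
          rw [Finset.card_compl, Finset.card_insert_of_notMem hr]
          omega
      rw [if_neg (Finset.insert_ne_empty r T), Finset.card_insert_of_notMem hr,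
        Nat.add_sub_cancel, htel]
      calc _ ≤ ∑ a ∈ Finset.range L, ((if T = ∅ then 0 else
            (L - (a + 1) + (T.card - 1)).choose (T.card - 1) : ℕ) * B) + B :=
            (abs_add_le _ _).trans (add_le_add
              ((Finset.abs_sum_le_sum_abs _ _).trans (Finset.sum_le_sum hstep)) hrem)
        _ = ((∑ a ∈ Finset.range L, (if T = ∅ then 0 else
            (L - (a + 1) + (T.card - 1)).choose (T.card - 1)) + 1 : ℕ) : ℝ) * B := by
            rw [← Finset.sum_mul]; push_cast; ring
        _ ≤ _ := by
            refine mul_le_mul_of_nonneg_right ?_ hB0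
            rw [Nat.cast_le]
            rcases T.eq_empty_or_nonempty with rfl | hT
            · simp
            · simp only [if_neg hT.ne_empty]
              obtain ⟨m, hm⟩ := Nat.exists_eq_succ_of_ne_zero hT.card_pos.ne'
              rw [hm]
              exact sum_range_choose_add_le m L
  have h := key Finset.univ M (fun _ => 0) (fun _ => none) (by simp) (by simp) (by simp)
  rw [if_neg Finset.univ_nonempty.ne_empty, Finset.card_univ] at h
  have h0 : levelSum b p A x g (fun _ => 0) (fun _ => none) =
      ∑ n ∈ A, ∫ τ in box b p, altSum g (x n) τ := by
    refine Finset.sum_congr rfl fun n hn => ?_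
    refine setIntegral_congr_fun (measurableSet_box b p) fun τ hτ => ?_
    have hxn := (mem_box_iff hb0 p _).1 (hx.1 n hn)
    have hτ := (mem_box_iff hb0 p _).1 hτ
    have e1 : mixPoint b p (x n) τ (fun _ => none) = x n := rfl
    have e2 : mixPoint b p (x n) τ (fun _ => some 0) = τ :=
      funext fun i => mixDigits_zero ((hxn i).trans (hτ i).symm)
    simp only [e1, e2]
  rw [h0] at h
  have hk : 0 < Fintype.card ι := Fintype.card_pos
  rwa [Nat.add_sub_assoc (by omega)]

end

/-! ### Counting the points of a digital net -/

lemma sum_digits_lt {b : ℕ} (m : ℕ) (v : Fin m → ℕ) (hv : ∀ r, v r < b) :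
    ∑ r, v r * b ^ (m - 1 - (r : ℕ)) < b ^ m := by
  induction m with
  | zero => simp
  | succ m ih =>
    have h := ih (fun r => v r.succ) fun r => hv _
    have h0 := hv 0
    rw [Fin.sum_univ_succ]
    have : ∑ r : Fin m, v r.succ * b ^ (m + 1 - 1 - (r.succ : ℕ)) =
        ∑ r : Fin m, v r.succ * b ^ (m - 1 - (r : ℕ)) := by
      refine Finset.sum_congr rfl fun r _ => ?_
      congr 2
      simp only [Fin.val_succ]
      omega
    rw [this]
    simp only [Fin.val_zero, Nat.add_sub_cancel, Nat.sub_zero]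
    calc v 0 * b ^ m + _ < v 0 * b ^ m + b ^ m := by gcongr
      _ = (v 0 + 1) * b ^ m := by ring
      _ ≤ b * b ^ m := by gcongr; omega
      _ = b ^ (m + 1) := by ring

lemma netLabel_lt {b m : ℕ} [NeZero b] (C : Matrix (Fin m) (Fin m) (ZMod b)) (n : ℕ) :
    netLabel C n < b ^ m :=
  sum_digits_lt m _ fun _ => ZMod.val_lt _

lemma div_pow_mem_Ico_iff {b m k : ℕ} (hb : 0 < b) (hk : k ≤ m) (η a : ℕ) :
    (η : ℝ) / (b : ℝ) ^ m ∈ Set.Ico ((a : ℝ) / (b : ℝ) ^ k) (((a : ℝ) + 1) / (b : ℝ) ^ k) ↔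
      η / b ^ (m - k) = a := by
  have hbR : (0 : ℝ) < b := by exact_mod_cast hb
  have hm : (b : ℝ) ^ m = (b : ℝ) ^ (m - k) * (b : ℝ) ^ k := by
    rw [← pow_add, Nat.sub_add_cancel hk]
  have e1 : (η : ℝ) / (b : ℝ) ^ m = (η / (b : ℝ) ^ (m - k)) / (b : ℝ) ^ k := by
    rw [hm, div_div]
  rw [e1, Set.mem_Ico, div_le_div_iff_of_pos_right (by positivity),
    div_lt_div_iff_of_pos_right (by positivity), le_div_iff₀ (by positivity),
    div_lt_iff₀ (by positivity), Nat.div_eq_iff (by positivity)]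
  have hpos : 0 < b ^ (m - k) := by positivity
  constructor
  · rintro ⟨h1, h2⟩
    have h1' : a * b ^ (m - k) ≤ η := by exact_mod_cast h1
    have h2' : η < (a + 1) * b ^ (m - k) := by exact_mod_cast h2
    rw [add_mul, one_mul] at h2'
    omega
  · rintro ⟨h1, h2⟩
    refine ⟨by exact_mod_cast h1, ?_⟩
    have : η < (a + 1) * b ^ (m - k) := by rw [add_mul, one_mul]; omega
    exact_mod_cast this

/-- The net property for elementary intervals of any volume that is at least `b^{t-m}`. -/
lemma IsDigitalNet.card_filter {b m s t : ℕ} [NeZero b] (hs : 1 ≤ s)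
    {C : Fin s → Matrix (Fin m) (Fin m) (ZMod b)} (hC : IsDigitalNet t C) (k a : Fin s → ℕ)
    (hk : ∑ i, k i + t ≤ m) (ha : ∀ i, a i < b ^ k i) :
    (Finset.univ.filter fun n : Fin (b ^ m) =>
      ∀ i, netLabel (C i) n / b ^ (m - k i) = a i).card = b ^ (m - ∑ i, k i) := by
  have hb : 0 < b := Nat.pos_of_ne_zero (NeZero.ne b)
  obtain ⟨r, hr⟩ := Nat.exists_eq_add_of_le hk
  induction r generalizing k a with
  | zero =>
    have h := hC.2 k a (by omega) ha
    rw [show m - ∑ i, k i = t by omega, ← h, ← Set.ncard_coe_finset]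
    congr 1
    ext n
    simp only [Finset.coe_filter, Finset.mem_univ, true_and, Set.mem_ofPred_eq]
    refine forall_congr' fun i => (div_pow_mem_Ico_iff hb ?_ _ _).symm
    have := Finset.single_le_sum (f := k) (fun _ _ => Nat.zero_le _) (Finset.mem_univ i)
    omega
  | succ r ih =>
    let i₀ : Fin s := ⟨0, hs⟩
    have hki := Finset.single_le_sum (f := k) (fun _ _ => Nat.zero_le _) (Finset.mem_univ i₀)
    have hsum : ∑ i, Function.update k i₀ (k i₀ + 1) i = ∑ i, k i + 1 := by
      rw [Finset.sum_update_of_mem (Finset.mem_univ _),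
        ← Finset.add_sum_erase _ k (Finset.mem_univ i₀), Finset.sdiff_singleton_eq_erase]
      ring
    have hpow : b ^ (m - k i₀) = b ^ (m - (k i₀ + 1)) * b := by
      rw [← pow_succ]; congr 1; omega
    rw [Finset.card_eq_sum_card_fiberwise (t := Finset.range b)
      (f := fun n : Fin (b ^ m) => netLabel (C i₀) n / b ^ (m - (k i₀ + 1)) % b)
      (fun n _ => Finset.mem_coe.2 (Finset.mem_range.2 (Nat.mod_lt _ hb)))]
    have hfib : ∀ c ∈ Finset.range b, ((Finset.univ.filter fun n : Fin (b ^ m) =>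
        ∀ i, netLabel (C i) n / b ^ (m - k i) = a i).filter fun n : Fin (b ^ m) =>
        netLabel (C i₀) n / b ^ (m - (k i₀ + 1)) % b = c).card = b ^ (m - (∑ i, k i + 1)) := by
      intro c hc
      rw [Finset.mem_range] at hc
      rw [← hsum, ← ih (Function.update k i₀ (k i₀ + 1)) (Function.update a i₀ (b * a i₀ + c))
        (by omega) ?_ (by omega)]
      · congr 1
        ext n
        simp only [Finset.mem_filter, Finset.mem_univ, true_and]
        have hdiv : ∀ η : ℕ, (η / b ^ (m - k i₀) = a i₀ ∧ η / b ^ (m - (k i₀ + 1)) % b = c) ↔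
            η / b ^ (m - (k i₀ + 1)) = b * a i₀ + c := by
          intro η
          rw [hpow, ← Nat.div_div_eq_div_mul]
          constructor
          · rintro ⟨h1, h2⟩
            rw [← h1, ← h2, Nat.div_add_mod]
          · intro h
            rw [h]
            refine ⟨?_, ?_⟩
            · rw [Nat.mul_add_div hb, Nat.div_eq_of_lt hc, add_zero]
            · rw [Nat.mul_add_mod, Nat.mod_eq_of_lt hc]
        constructor
        · rintro ⟨h1, h2⟩ i
          by_cases hi : i = i₀
          · subst hi
            simpa using (hdiv _).1 ⟨h1 _, h2⟩
          · simpa [hi] using h1 i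
        · intro h
          have h0 := h i₀
          rw [Function.update_self, Function.update_self] at h0
          obtain ⟨h1, h2⟩ := (hdiv _).2 h0
          refine ⟨fun i => ?_, h2⟩
          by_cases hi : i = i₀
          · rw [hi]; exact h1
          · simpa [hi] using h i
      · intro i
        by_cases hi : i = i₀
        · subst hi
          rw [Function.update_self, Function.update_self, pow_succ]
          have := ha i₀
          calc b * a i₀ + c < b * a i₀ + b := by omega
            _ = (a i₀ + 1) * b := by ring
            _ ≤ b ^ k i₀ * b := by gcongr; omega
        · simpa [hi] using ha i
    rw [Finset.sum_congr rfl hfib, Finset.sum_const, Finset.card_range, smul_eq_mul, ← pow_succ']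
    congr 1
    omega

/-! ### The look-up table -/

section lookup
variable {Δ b : ℕ} {μ : Fin Δ → ℕ}

lemma labelStart_add_le {d d' : Fin Δ} (h : d < d') :
    labelStart b μ d + b ^ μ d ≤ labelStart b μ d' := by
  rw [labelStart, labelStart, add_comm,
    ← Finset.sum_insert (f := fun d => b ^ μ d) (a := d) (s := Finset.Iio d) (by simp)]
  refine Finset.sum_le_sum_of_subset fun i hi => ?_
  rw [Finset.mem_insert, Finset.mem_Iio] at hi
  rw [Finset.mem_Iio]
  rcases hi with rfl | hi
  · exact h
  · exact hi.trans h

lemma labelStart_add_le_sum (d : Fin Δ) : labelStart b μ d + b ^ μ d ≤ ∑ d, b ^ μ d := by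
  rw [labelStart, add_comm,
    ← Finset.sum_insert (f := fun d => b ^ μ d) (a := d) (s := Finset.Iio d) (by simp)]
  exact Finset.sum_le_sum_of_subset (Finset.subset_univ _)

lemma exists_label_range {η : ℕ} (hη : η < ∑ d, b ^ μ d) :
    ∃ d, labelStart b μ d ≤ η ∧ η < labelStart b μ d + b ^ μ d := by
  by_contra hcon
  push Not at hcon
  have key : ∀ j ≤ Δ, ∑ d ∈ Finset.univ.filter (fun d : Fin Δ => (d : ℕ) < j), b ^ μ d ≤ η := by
    intro j
    induction j with
    | zero => simp
    | succ j ih =>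
      intro hj
      have h1 := ih (by omega)
      have h2 : Finset.univ.filter (fun d : Fin Δ => (d : ℕ) < j) = Finset.Iio ⟨j, hj⟩ := by
        ext d; simp [Fin.lt_def]
      have h3 : Finset.univ.filter (fun d : Fin Δ => (d : ℕ) < j + 1) =
          insert ⟨j, hj⟩ (Finset.Iio ⟨j, hj⟩) := by
        ext d
        simp only [Finset.mem_filter, Finset.mem_univ, true_and, Finset.mem_insert,
          Finset.mem_Iio, Fin.lt_def, Fin.ext_iff]
        omega
      rw [h2] at h1
      rw [h3, Finset.sum_insert (by simp), add_comm]
      exact hcon _ h1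
  have := key Δ le_rfl
  rw [Finset.filter_true_of_mem fun d _ => d.2] at this
  omega

lemma label_range_unique {η : ℕ} {d d' : Fin Δ}
    (h : labelStart b μ d ≤ η ∧ η < labelStart b μ d + b ^ μ d)
    (h' : labelStart b μ d' ≤ η ∧ η < labelStart b μ d' + b ^ μ d') : d = d' := by
  rcases lt_trichotomy d d' with hlt | heq | hlt
  · have := labelStart_add_le (b := b) (μ := μ) hlt; omega
  · exact heq
  · have := labelStart_add_le (b := b) (μ := μ) hlt; omega

lemma lookup_eq (e : Fin Δ → ℤ × ℤ) {η : ℕ} {d : Fin Δ}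
    (h : labelStart b μ d ≤ η ∧ η < labelStart b μ d + b ^ μ d) :
    lookup b e μ η = (b : ℝ) ^ (e d).1 * (e d).2 +
        ((η - labelStart b μ d : ℕ) : ℝ) * (b : ℝ) ^ ((e d).1 - (μ d : ℤ)) := by
  rw [lookup, Finset.sum_eq_single d, if_pos h]
  · intro d' _ hne
    exact if_neg fun h' => hne (label_range_unique h' h)
  · simp

lemma floor_lookup (hb : 0 < b) (e : Fin Δ → ℤ × ℤ) {η : ℕ} {d : Fin Δ}
    (h : labelStart b μ d ≤ η ∧ η < labelStart b μ d + b ^ μ d) {c : ℕ} (hc : c ≤ μ d) :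
    ⌊lookup b e μ η / (b : ℝ) ^ ((e d).1 - (c : ℤ))⌋ =
      (e d).2 * (b : ℤ) ^ c + (((η - labelStart b μ d) / b ^ (μ d - c) : ℕ) : ℤ) := by
  have hbR : (b : ℝ) ≠ 0 := by positivity
  have h1 : lookup b e μ η / (b : ℝ) ^ ((e d).1 - (c : ℤ)) =
      (((e d).2 * (b : ℤ) ^ c : ℤ) : ℝ) +
        ((η - labelStart b μ d : ℕ) : ℝ) / ((b ^ (μ d - c) : ℕ) : ℝ) := by
    rw [lookup_eq e h]
    have h2 : (b : ℝ) ^ (μ d) = (b : ℝ) ^ (μ d - c) * (b : ℝ) ^ c := by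
      rw [← pow_add, Nat.sub_add_cancel hc]
    rw [zpow_sub₀ hbR, zpow_sub₀ hbR, zpow_natCast, zpow_natCast, h2]
    push_cast
    have : (b : ℝ) ^ (e d).1 ≠ 0 := zpow_ne_zero _ hbR
    field_simp
  rw [h1, Int.floor_intCast_add]
  congr 1
  rw [← Int.natCast_floor_eq_floor (by positivity), Nat.floor_div_eq_div]

lemma lookup_mem_interval (hb : 0 < b) (e : Fin Δ → ℤ × ℤ) {η : ℕ} {d : Fin Δ}
    (h : labelStart b μ d ≤ η ∧ η < labelStart b μ d + b ^ μ d) :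
    lookup b e μ η ∈ interval b (e d) := by
  have h1 := floor_lookup hb e h (Nat.zero_le _)
  rw [mem_interval_iff hb]
  rw [Nat.div_eq_of_lt (by rw [Nat.sub_zero]; omega)] at h1
  simpa using h1

/-- The points of the `d`-th interval are those with labels in the `d`-th range. -/
lemma lookup_mem_interval_iff (hb : 0 < b) {D : Set (ℤ × ℤ)}
    (hD : D.PairwiseDisjoint (interval b)) {e : Fin Δ → ℤ × ℤ} (he : Function.Injective e)
    (heD : ∀ d, e d ∈ D) {η : ℕ} (hη : η < ∑ d, b ^ μ d) (d : Fin Δ) :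
    lookup b e μ η ∈ interval b (e d) ↔
      labelStart b μ d ≤ η ∧ η < labelStart b μ d + b ^ μ d := by
  refine ⟨fun h => ?_, lookup_mem_interval hb e⟩
  obtain ⟨d', hd'⟩ := exists_label_range hη
  have h' := lookup_mem_interval hb e hd'
  have : d = d' := by
    by_contra hne
    have hdis : Disjoint (interval b (e d)) (interval b (e d')) :=
      hD (heD d) (heD d') fun heq => hne (he heq)
    exact Set.disjoint_left.1 hdis h h'
  rw [this]
  exact hd'

lemma dvd_labelStart (hμ : Antitone μ) (d : Fin Δ) : b ^ μ d ∣ labelStart b μ d :=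
  Finset.dvd_sum fun _ hd' => pow_dvd_pow _ (hμ (Finset.mem_Iio.1 hd').le)

/-- A cell of level `c` in the `d`-th interval corresponds to an elementary interval of labels:
by monotonicity, the `d`-th range of labels starts at a multiple of its length. -/
lemma floor_lookup_eq_iff (hb : 0 < b) {D : Set (ℤ × ℤ)}
    (hD : D.PairwiseDisjoint (interval b)) {e : Fin Δ → ℤ × ℤ} (he : Function.Injective e)
    (heD : ∀ d, e d ∈ D) (hμ : Antitone μ) {η : ℕ} (hη : η < ∑ d, b ^ μ d) (d : Fin Δ) {c : ℕ}
    (hc : c ≤ μ d) {q : ℕ} (hq : q < b ^ c) :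
    ⌊lookup b e μ η / (b : ℝ) ^ ((e d).1 - (c : ℤ))⌋ = (e d).2 * (b : ℤ) ^ c + q ↔
      η / b ^ (μ d - c) = labelStart b μ d / b ^ μ d * b ^ c + q := by
  obtain ⟨w, hw⟩ := dvd_labelStart (b := b) hμ d
  have hpos : 0 < b ^ (μ d - c) := by positivity
  have hpow : b ^ μ d = b ^ (μ d - c) * b ^ c := by rw [← pow_add, Nat.sub_add_cancel hc]
  have hw' : labelStart b μ d / b ^ μ d = w := by
    rw [hw, Nat.mul_div_cancel_left _ (by positivity)]
  have hdiv : labelStart b μ d ≤ η → η / b ^ (μ d - c) =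
      w * b ^ c + (η - labelStart b μ d) / b ^ (μ d - c) := by
    intro h
    obtain ⟨r, rfl⟩ := Nat.exists_eq_add_of_le h
    rw [Nat.add_sub_cancel_left, hw, hpow, mul_assoc, Nat.mul_add_div hpos]
    ring
  rw [hw']
  constructor
  · intro h
    have hin : lookup b e μ η ∈ interval b (e d) := by
      rw [mem_interval_iff hb, floor_div_zpow_sub hb _ c, h]
      push_cast
      rw [Int.add_comm, Int.add_mul_ediv_right _ _ (by positivity),
        Int.ediv_eq_zero_of_lt (by positivity) (by exact_mod_cast hq), zero_add]
    have hr := (lookup_mem_interval_iff hb hD he heD hη d).1 hin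
    rw [floor_lookup hb e hr hc] at h
    have h' : (η - labelStart b μ d) / b ^ (μ d - c) = q := by
      have := add_left_cancel h
      exact_mod_cast this
    rw [hdiv hr.1, h']
  · intro h
    have h1 : η / b ^ μ d = w := by
      rw [hpow, ← Nat.div_div_eq_div_mul, h, Nat.mul_comm, Nat.mul_add_div (by positivity),
        Nat.div_eq_of_lt hq, add_zero]
    have hr : labelStart b μ d ≤ η ∧ η < labelStart b μ d + b ^ μ d := by
      have hpos' : 0 < b ^ μ d := by positivity
      have h2 := Nat.div_add_mod η (b ^ μ d)
      have h3 := Nat.mod_lt η hpos'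
      rw [h1, ← hw] at h2
      generalize η % b ^ μ d = r at h2 h3
      omega
    rw [floor_lookup hb e hr hc]
    have := hdiv hr.1
    rw [h] at this
    have := add_left_cancel this
    rw [← this]

end lookup

/-! ### The points in one box form a local net -/

section
variable {b m s t : ℕ} {Δ : Fin s → ℕ}

lemma mIndex_le {μ : (i : Fin s) → Fin (Δ i) → ℕ} (hμ_le : ∀ i d, μ i d ≤ m)
    (d : (i : Fin s) → Fin (Δ i)) (i : Fin s) : mIndex m μ d ≤ μ i (d i) := by
  have := Finset.single_le_sum (f := fun i => (m : ℤ) - (μ i (d i) : ℤ))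
    (fun i _ => sub_nonneg.2 (by exact_mod_cast hμ_le i (d i))) (Finset.mem_univ i)
  rw [mIndex]
  omega

variable [NeZero b] (hs : 1 ≤ s) {D : Fin s → Set (ℤ × ℤ)}
  (hD : ∀ i, (D i).PairwiseDisjoint (interval b))
  {e : (i : Fin s) → Fin (Δ i) → ℤ × ℤ} (he : ∀ i, Function.Injective (e i))
  (heD : ∀ i d, e i d ∈ D i) {μ : (i : Fin s) → Fin (Δ i) → ℕ} (hμ_anti : ∀ i, Antitone (μ i))
  (hμ_le : ∀ i d, μ i d ≤ m) (hμ_sum : ∀ i, ∑ d, b ^ μ i d = b ^ m)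
  {C : Fin s → Matrix (Fin m) (Fin m) (ZMod b)} (hC : IsDigitalNet t C)

include hs hD he heD hμ_anti hμ_le hμ_sum hC

/-- The cells of a box correspond to elementary intervals of labels, so the net property counts
the points in them. -/
lemma card_filter_cellIndex_netPoint (d : (i : Fin s) → Fin (Δ i)) (a : Fin s → ℕ)
    (ha : ((∑ i, a i : ℕ) : ℤ) + t ≤ mIndex m μ d) (κ : Fin s → ℤ)
    (hκ : κ ∈ cellIndices b (boxCode e d) a) :
    (Finset.univ.filter fun n : Fin (b ^ m) =>
      cellIndex b (boxCode e d) a (netPoint C e μ n) = κ).card =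
      b ^ (m - (∑ i, (m - μ i (d i)) + ∑ i, a i)) := by
  have hb : 0 < b := Nat.pos_of_ne_zero (NeZero.ne b)
  have haμ : ∀ i, a i ≤ μ i (d i) := by
    intro i
    have h1 := mIndex_le hμ_le d i
    have h2 := Finset.single_le_sum (f := a) (fun _ _ => Nat.zero_le _) (Finset.mem_univ i)
    omega
  have hsum : (∑ i, ((m - μ i (d i)) + a i)) + t ≤ m := by
    rw [Finset.sum_add_distrib]
    have h : ((∑ i, (m - μ i (d i)) : ℕ) : ℤ) = ∑ i, ((m : ℤ) - (μ i (d i) : ℤ)) := by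
      push_cast
      exact Finset.sum_congr rfl fun i _ => by rw [Nat.cast_sub (hμ_le i (d i))]
    rw [mIndex, ← h] at ha
    omega
  rw [cellIndices, Fintype.mem_piFinset] at hκ
  choose q hq using fun i => Int.le.dest (Finset.mem_Ico.1 (hκ i)).1
  have hqb : ∀ i, q i < b ^ a i := by
    intro i
    have := (Finset.mem_Ico.1 (hκ i)).2
    rw [← hq i, add_mul, one_mul] at this
    have := lt_of_add_lt_add_left this
    exact_mod_cast this
  have key := hC.card_filter hs (fun i => (m - μ i (d i)) + a i)
    (fun i => labelStart b (μ i) (d i) / b ^ μ i (d i) * b ^ a i + q i) hsum fun i => by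
      have h1 := labelStart_add_le_sum (b := b) (μ := μ i) (d i)
      obtain ⟨w, hw⟩ := dvd_labelStart (b := b) (hμ_anti i) (d i)
      have h2 : b ^ m = b ^ μ i (d i) * b ^ (m - μ i (d i)) := by
        rw [← pow_add, Nat.add_sub_cancel' (hμ_le i (d i))]
      rw [hμ_sum, hw, h2, ← Nat.mul_succ] at h1
      have h3 := Nat.le_of_mul_le_mul_left h1 (by positivity)
      rw [hw, Nat.mul_div_cancel_left _ (by positivity), pow_add]
      calc w * b ^ a i + q i < w * b ^ a i + b ^ a i := by have := hqb i; omega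
        _ = w.succ * b ^ a i := by rw [Nat.succ_mul]
        _ ≤ _ := by gcongr
  rw [← Finset.sum_add_distrib, ← key]
  congr 1
  ext n
  simp only [Finset.mem_filter, Finset.mem_univ, true_and, funext_iff]
  refine forall_congr' fun i => ?_
  have h := floor_lookup_eq_iff hb (hD i) (he i) (heD i) (hμ_anti i)
    (η := netLabel (C i) n) (by rw [hμ_sum]; exact netLabel_lt _ _) (d i) (haμ i) (hqb i)
  have h4 : m - (m - μ i (d i) + a i) = μ i (d i) - a i := by
    have := hμ_le i (d i)
    omega
  rw [h4, ← h, ← hq i]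
  rfl

open Classical in
lemma isLocalNet_netPoint (d : (i : Fin s) → Fin (Δ i)) (hd : (t : ℤ) ≤ mIndex m μ d) :
    IsLocalNet b (boxCode e d) (mIndex m μ d - t).toNat
      (Finset.univ.filter fun n => netPoint C e μ n ∈ box b (boxCode e d)) (netPoint C e μ) ∧
    (Finset.univ.filter fun n => netPoint C e μ n ∈ box b (boxCode e d)).Nonempty := by
  have hb : 0 < b := Nat.pos_of_ne_zero (NeZero.ne b)
  have hA := card_filter_cellIndex_netPoint hs hD he heD hμ_anti hμ_le hμ_sum hC d (fun _ => 0)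
    (by simpa using hd) (fun i => (boxCode e d i).2) (by simp [cellIndices])
  simp only [← mem_box_iff_cellIndex hb] at hA
  refine ⟨⟨fun n hn => (Finset.mem_filter.1 hn).2, fun a ha κ hκ => ?_⟩, ?_⟩
  · have hκc := card_filter_cellIndex_netPoint hs hD he heD hμ_anti hμ_le hμ_sum hC d a
      (by omega) κ hκ
    rw [Finset.filter_filter, hA]
    have : (Finset.univ.filter fun n => netPoint C e μ n ∈ box b (boxCode e d) ∧
        cellIndex b (boxCode e d) a (netPoint C e μ n) = κ) = Finset.univ.filter fun n =>
        cellIndex b (boxCode e d) a (netPoint C e μ n) = κ := by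
      ext n
      simp only [Finset.mem_filter, Finset.mem_univ, true_and, and_iff_right_iff_imp]
      intro h
      rw [← floor_mem_cellIndices_iff hb _ a, h]
      exact hκ
    rw [this, hκc, ← pow_add]
    congr 1
    have h : ((∑ i, (m - μ i (d i)) : ℕ) : ℤ) = ∑ i, ((m : ℤ) - (μ i (d i) : ℤ)) := by
      push_cast
      exact Finset.sum_congr rfl fun i _ => by rw [Nat.cast_sub (hμ_le i (d i))]
    rw [mIndex, ← h] at ha hd
    simp only [Finset.sum_const_zero]
    omega
  · rw [← Finset.card_pos, hA]
    positivity

end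

/-- Projecting a local net onto the coordinates in `u`. -/
lemma IsLocalNet.restrict {ι N : Type*} [Fintype ι] [DecidableEq ι] {b : ℕ} (hb : 0 < b)
    {p : ι → ℤ × ℤ} {M : ℕ} {A : Finset N} {x : N → ι → ℝ} (hx : IsLocalNet b p M A x)
    (u : Finset ι) :
    IsLocalNet b (fun i : {i // i ∈ u} => p i) M A (fun n i => x n i) := by
  refine ⟨fun n hn i => hx.1 n hn i, fun a ha κ hκ => ?_⟩
  let a' : ι → ℕ := fun i => if h : i ∈ u then a ⟨i, h⟩ else 0
  let κ' : ι → ℤ := fun i => if h : i ∈ u then κ ⟨i, h⟩ else (p i).2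
  have hsum : ∑ i, a' i = ∑ i, a i := by
    rw [← Finset.sum_subset (Finset.subset_univ u) fun i _ hi => dif_neg hi, ← Finset.sum_attach]
    exact Finset.sum_congr rfl fun i _ => dif_pos i.2
  have hκ' : κ' ∈ cellIndices b p a' := by
    rw [mem_cellIndices_iff hb] at hκ ⊢
    intro i
    by_cases h : i ∈ u
    · simpa only [κ', a', dif_pos h] using hκ ⟨i, h⟩
    · simp [κ', a', h]
  have h := hx.2 a' (hsum ▸ ha) κ' hκ'
  rw [hsum] at h
  rw [← h]
  congr 2
  refine Finset.filter_congr fun n hn => ?_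
  rw [funext_iff, funext_iff]
  constructor
  · intro h1 i
    by_cases hi : i ∈ u
    · simpa only [κ', a', cellIndex, dif_pos hi] using h1 ⟨i, hi⟩
    · simpa [κ', a', cellIndex, hi] using (mem_box_iff hb p _).1 (hx.1 n hn) i
  · intro h1 i
    simpa only [κ', a', cellIndex, dif_pos i.2] using h1 i

/-! ### Expansion of the error into alternating sums of marginals -/

section
variable {s : ℕ}

lemma altSum_glue_eq (u : Finset (Fin s)) (f : (Fin s → ℝ) → ℝ) (x τ : Fin s → ℝ) :
    altSum (fun z : {i // i ∈ u} → ℝ => f (glue u z fun i => τ i)) (fun i => x i) (fun i => τ i) =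
      ∑ v ∈ u.powerset, (-1 : ℝ) ^ v.card * f ((u \ v).piecewise x τ) := by
  rw [altSum]
  refine Finset.sum_nbij' (fun v => v.map (Function.Embedding.subtype _))
    (fun v => v.subtype (· ∈ u)) ?_ ?_ ?_ ?_ ?_
  · intro v _
    rw [Finset.mem_powerset]
    intro i hi
    obtain ⟨j, -, rfl⟩ := Finset.mem_map.1 hi
    exact j.2
  · simp
  · intro v _
    ext i
    simp
  · intro v hv
    rw [Finset.subtype_map, Finset.filter_true_of_mem fun i hi => Finset.mem_powerset.1 hv hi]
  · intro v _
    rw [Finset.card_map]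
    congr 2
    ext i
    by_cases hi : i ∈ u
    · by_cases hv : (⟨i, hi⟩ : {i // i ∈ u}) ∈ v <;> simp [glue, Finset.piecewise, hi, hv]
    · simp [glue, Finset.piecewise, hi]

/-- The product expansion `∏_i δ_{x_i} = ∏_i (δ_{τ_i} + (δ_{x_i} - δ_{τ_i}))`. -/
lemma eval_eq_sum_altSum (f : (Fin s → ℝ) → ℝ) (x τ : Fin s → ℝ) :
    f x = ∑ u : Finset (Fin s), altSum (fun z : {i // i ∈ u} → ℝ => f (glue u z fun i => τ i))
      (fun i => x i) (fun i => τ i) := by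
  simp only [altSum_glue_eq]
  have h : ∑ u : Finset (Fin s), ∑ v ∈ u.powerset,
      (-1 : ℝ) ^ v.card * f ((u \ v).piecewise x τ) =
      ∑ w : Finset (Fin s), ∑ v ∈ wᶜ.powerset, (-1 : ℝ) ^ v.card * f (w.piecewise x τ) := by
    rw [Finset.sum_sigma', Finset.sum_sigma']
    refine Finset.sum_nbij' (fun q => ⟨q.1 \ q.2, q.2⟩) (fun q => ⟨q.1 ∪ q.2, q.2⟩) ?_ ?_ ?_ ?_ ?_
    · rintro ⟨u, v⟩ _
      simp only [Finset.mem_sigma, Finset.mem_univ, true_and, Finset.mem_powerset]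
      intro i hi
      simp [hi]
    · rintro ⟨w, v⟩ _
      exact Finset.mem_sigma.2 ⟨Finset.mem_univ _, Finset.mem_powerset.2 Finset.subset_union_right⟩
    · rintro ⟨u, v⟩ huv
      simp only [Finset.mem_sigma, Finset.mem_univ, true_and, Finset.mem_powerset] at huv
      simp [Finset.sdiff_union_of_subset huv]
    · rintro ⟨w, v⟩ hwv
      simp only [Finset.mem_sigma, Finset.mem_univ, true_and, Finset.mem_powerset] at hwv
      have : (w ∪ v) \ v = w := by
        rw [Finset.union_sdiff_right, Finset.sdiff_eq_self_iff_disjoint]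
        exact (Finset.subset_compl_iff_disjoint_left.1 hwv)
      simp [this]
    · rintro ⟨u, v⟩ _
      rfl
  rw [h, Finset.sum_eq_single Finset.univ]
  · simp
  · intro w _ hw
    have hne : wᶜ.Nonempty := by
      rw [Finset.nonempty_iff_ne_empty, Ne, Finset.compl_eq_empty_iff]
      exact hw
    have h0 : (∑ v ∈ wᶜ.powerset, (-1 : ℝ) ^ v.card) = 0 := by
      exact_mod_cast Finset.sum_powerset_neg_one_pow_card_of_nonempty hne
    rw [← Finset.sum_mul, h0, zero_mul]
  · simp

lemma box_subset_isCompact {ι : Type*} (b : ℕ) (p : ι → ℤ × ℤ) :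
    ∃ K : Set (ι → ℝ), IsCompact K ∧ box b p ⊆ K := by
  refine ⟨Set.univ.pi fun i => Set.Icc ((b : ℝ) ^ (p i).1 * (p i).2)
    ((b : ℝ) ^ (p i).1 * ((p i).2 + 1)), isCompact_univ_pi fun i => isCompact_Icc, ?_⟩
  rw [box_eq_pi_Ico]
  exact Set.pi_mono fun i _ => Set.Ico_subset_Icc_self

lemma integrableOn_box_of_continuous {ι : Type*} [Fintype ι] (b : ℕ) (p : ι → ℤ × ℤ)
    {f : (ι → ℝ) → ℝ} (hf : Continuous f) : IntegrableOn f (box b p) := by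
  obtain ⟨K, hK, hsub⟩ := box_subset_isCompact b p
  exact (hf.continuousOn.integrableOn_compact hK).mono_set hsub

lemma exists_bound_on_box {ι : Type*} (b : ℕ) (p : ι → ℤ × ℤ) {f : (ι → ℝ) → ℝ}
    (hf : Continuous f) : ∃ c, ∀ z ∈ box b p, |f z| ≤ c := by
  obtain ⟨K, hK, hsub⟩ := box_subset_isCompact b p
  obtain ⟨c, hc⟩ := hK.exists_bound_of_continuousOn hf.continuousOn
  exact ⟨c, fun z hz => hc z (hsub hz)⟩

lemma continuous_glue (u : Finset (Fin s)) :
    Continuous fun q : ({i // i ∈ u} → ℝ) × ({i // i ∉ u} → ℝ) => glue u q.1 q.2 := by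
  refine continuous_pi fun i => ?_
  by_cases h : i ∈ u
  · simp only [glue, dif_pos h]; fun_prop
  · simp only [glue, dif_neg h]; fun_prop

lemma glue_mem_box {b : ℕ} {p : Fin s → ℤ × ℤ} {u : Finset (Fin s)} {z : {i // i ∈ u} → ℝ}
    {y : {i // i ∉ u} → ℝ} (hz : z ∈ box b fun i : {i // i ∈ u} => p i)
    (hy : y ∈ box b fun i : {i // i ∉ u} => p i) : glue u z y ∈ box b p := by
  intro i
  by_cases h : i ∈ u
  · simp only [glue, dif_pos h]; exact hz ⟨i, h⟩
  · simp only [glue, dif_neg h]; exact hy ⟨i, h⟩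

lemma measurable_marginal (b : ℕ) (p : Fin s → ℤ × ℤ) (u : Finset (Fin s))
    {f : (Fin s → ℝ) → ℝ} (hf : Continuous f) : Measurable (marginal b p u f) := by
  have h : StronglyMeasurable (Function.uncurry fun (z : {i // i ∈ u} → ℝ)
      (y : {i // i ∉ u} → ℝ) => f (glue u z y)) :=
    (hf.comp (continuous_glue u)).stronglyMeasurable
  exact (h.integral_prod_right (ν := volume.restrict (box b fun i : {i // i ∉ u} => p i))).measurable

lemma exists_bound_marginal (b : ℕ) (p : Fin s → ℤ × ℤ) (u : Finset (Fin s))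
    {f : (Fin s → ℝ) → ℝ} (hf : Continuous f) :
    ∃ c, ∀ z ∈ box b (fun i : {i // i ∈ u} => p i), |marginal b p u f z| ≤ c := by
  obtain ⟨c, hc⟩ := exists_bound_on_box b p hf
  refine ⟨c * volume.real (box b fun i : {i // i ∉ u} => p i), fun z hz => ?_⟩
  rw [← Real.norm_eq_abs, marginal]
  exact norm_setIntegral_le_of_norm_le_const (volume_box_lt_top _ _)
    fun y hy => hc _ (glue_mem_box hz hy)

/-- Integrating the alternating sums over the box gives alternating sums of marginals. -/
lemma setIntegral_altSum_glue (b : ℕ) (p : Fin s → ℤ × ℤ) (u : Finset (Fin s))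
    {f : (Fin s → ℝ) → ℝ} (hf : Continuous f) (x : Fin s → ℝ) :
    ∫ τ in box b p, altSum (fun z : {i // i ∈ u} → ℝ => f (glue u z fun i => τ i))
      (fun i => x i) (fun i => τ i) =
    ∫ τ in box b (fun i : {i // i ∈ u} => p i), altSum (marginal b p u f) (fun i => x i) τ := by
  let G : ({i // i ∈ u} → ℝ) × ({i // i ∉ u} → ℝ) → ℝ := fun q =>
    altSum (fun z => f (glue u z q.2)) (fun i => x i) q.1
  let E := MeasurableEquiv.piEquivPiSubtypeProd (fun _ : Fin s => ℝ) (· ∈ u)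
  have hE : MeasurePreserving E volume volume := by
    convert volume_preserving_piEquivPiSubtypeProd (fun _ : Fin s => ℝ) (· ∈ u) <;> rfl
  have hpre : box b p = E ⁻¹' (box b (fun i : {i // i ∈ u} => p i) ×ˢ
      box b (fun i : {i // i ∉ u} => p i)) := by
    ext τ
    constructor
    · exact fun h => ⟨fun i => h i, fun i => h i⟩
    · rintro ⟨h1, h2⟩ i
      by_cases hi : i ∈ u
      · exact h1 ⟨i, hi⟩
      · exact h2 ⟨i, hi⟩
  have hterm : ∀ v : Finset {i // i ∈ u}, Continuous
      fun q : ({i // i ∈ u} → ℝ) × ({i // i ∉ u} → ℝ) =>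
        f (glue u (fun i => if i ∈ v then q.1 i else x i) q.2) := by
    intro v
    have h : Continuous fun q : ({i // i ∈ u} → ℝ) × ({i // i ∉ u} → ℝ) =>
        fun i : {i // i ∈ u} => if i ∈ v then q.1 i else x i := by
      refine continuous_pi fun i => ?_
      split_ifs <;> fun_prop
    exact hf.comp ((continuous_glue u).comp (h.prodMk continuous_snd))
  have hG : Continuous G := continuous_finsetSum _ fun v _ => (hterm v).const_mul _
  have hGint : IntegrableOn G (box b (fun i : {i // i ∈ u} => p i) ×ˢ
      box b (fun i : {i // i ∉ u} => p i)) (volume.prod volume) := by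
    obtain ⟨K, hK, hsub⟩ := box_subset_isCompact b (fun i : {i // i ∈ u} => p i)
    obtain ⟨K', hK', hsub'⟩ := box_subset_isCompact b (fun i : {i // i ∉ u} => p i)
    exact (hG.continuousOn.integrableOn_compact (hK.prod hK')).mono_set (Set.prod_mono hsub hsub')
  calc _ = ∫ τ in E ⁻¹' (box b (fun i : {i // i ∈ u} => p i) ×ˢ
        box b (fun i : {i // i ∉ u} => p i)), G (E τ) := by rw [hpre]; rfl
    _ = ∫ q in box b (fun i : {i // i ∈ u} => p i) ×ˢ box b (fun i : {i // i ∉ u} => p i), G q :=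
        hE.setIntegral_preimage_emb E.measurableEmbedding G _
    _ = ∫ z in box b (fun i : {i // i ∈ u} => p i), ∫ y in box b (fun i : {i // i ∉ u} => p i),
        G (z, y) := setIntegral_prod G hGint
    _ = _ := by
        congr 1
        ext z
        simp only [G, altSum, marginal]
        rw [integral_finsetSum _ fun v _ => ?_]
        · simp only [integral_const_mul]
        · exact (integrableOn_box_of_continuous b _
            ((hterm v).comp (Continuous.prodMk_right z))).const_mul _

end

/-! ### The error in a single box -/

section
variable {s : ℕ}

lemma prod_zpow_eq_rpow {ι : Type*} [Fintype ι] {b : ℕ} (hb : 0 < b) (k : ι → ℤ) :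
    ∏ i, (b : ℝ) ^ k i = (b : ℝ) ^ ((∑ i, k i : ℤ) : ℝ) := by
  have hbR : (0 : ℝ) < b := by exact_mod_cast hb
  push_cast
  rw [Real.rpow_sum_of_pos hbR]
  exact Finset.prod_congr rfl fun i _ => (Real.rpow_intCast _ _).symm

/-- The error of the equal weight rule in a box is expanded over the sets `u` of coordinates; each
part is the error of a local net for the marginal of the integrand. -/
lemma IsLocalNet.abs_error_le {N : Type*} {b : ℕ} (hb : 2 ≤ b) {p : Fin s → ℤ × ℤ} {M : ℕ}
    {A : Finset N} {x : N → Fin s → ℝ} (hx : IsLocalNet b p M A x) (hA : A.Nonempty)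
    {f : (Fin s → ℝ) → ℝ} (hf : Continuous f) {α W : Finset (Fin s) → ℝ}
    (hα : ∀ u, u.Nonempty → 1 / 2 < α u) (hW : ∀ u, 0 ≤ W u)
    (hvar : ∀ u, u.Nonempty → localVar b (α u) p u f ≤ ENNReal.ofReal (W u)) :
    |(∏ i, (b : ℝ) ^ (p i).1) / A.card * ∑ n ∈ A, f (x n) - ∫ z in box b p, f z| ≤
      ∑ u : Finset (Fin s) with u.Nonempty, ((M + u.card - 1).choose (u.card - 1) : ℝ) *
        ((∏ i : {i // i ∈ u}, (b : ℝ) ^ (p i).1) ^ (α u + 1 / 2) * (b : ℝ) ^ (-α u * M) *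
        (((b : ℝ) - 1) ^ (α u - 1 / 2) * (b : ℝ) ^ (1 / 2 : ℝ)) ^ (u.card - 1) * W u) := by
  have hb0 : 0 < b := by omega
  have hA0 : (0 : ℝ) < A.card := by exact_mod_cast hA.card_pos
  set T : Finset (Fin s) → N → ℝ := fun u n =>
    ∫ τ in box b (fun i : {i // i ∈ u} => p i), altSum (marginal b p u f) (fun i => x n i) τ
  have hempty : ∀ n, T ∅ n = ∫ z in box b p, f z := by
    intro n
    simp only [T]
    rw [← setIntegral_altSum_glue b p ∅ hf (x n)]
    simp only [altSum_glue_eq]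
    simp only [Finset.powerset_empty, Finset.sum_singleton, Finset.card_empty, pow_zero, one_mul]
    rfl
  have hexp : ∀ n, (∏ i, (b : ℝ) ^ (p i).1) * f (x n) = ∑ u, T u n := by
    intro n
    rw [← volume_real_box, ← smul_eq_mul, ← setIntegral_const,
      setIntegral_congr_fun (measurableSet_box b p) fun τ _ => eval_eq_sum_altSum f (x n) τ,
      integral_finsetSum]
    · exact Finset.sum_congr rfl fun u _ => setIntegral_altSum_glue b p u hf (x n)
    · intro u _
      simp only [altSum_glue_eq]
      refine integrable_finsetSum _ fun v _ => ?_
      refine integrableOn_box_of_continuous b p ((hf.comp (continuous_pi fun i => ?_)).const_mul _)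
      by_cases h : i ∈ u \ v
      · simp only [Finset.piecewise, h, if_true]; fun_prop
      · simp only [Finset.piecewise, h, if_false]; fun_prop
  have hsplit : A.card * ((∏ i, (b : ℝ) ^ (p i).1) / A.card * ∑ n ∈ A, f (x n) -
      ∫ z in box b p, f z) = ∑ u : Finset (Fin s) with u.Nonempty, ∑ n ∈ A, T u n := by
    have h1 : ∀ n ∈ A, (∏ i, (b : ℝ) ^ (p i).1) * f (x n) - ∫ z in box b p, f z =
        ∑ u : Finset (Fin s) with u.Nonempty, T u n := by
      intro n _
      rw [hexp, ← hempty n, sub_eq_iff_eq_add, add_comm,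
        ← Finset.sum_filter_add_sum_filter_not Finset.univ (fun u : Finset (Fin s) => u.Nonempty),
        add_comm]
      congr 1
      have : (Finset.univ.filter fun u : Finset (Fin s) => ¬ u.Nonempty) = {∅} := by
        ext u; simp
      rw [this, Finset.sum_singleton]
    rw [Finset.sum_comm, ← Finset.sum_congr rfl h1, Finset.sum_sub_distrib, Finset.sum_const,
      ← Finset.mul_sum, nsmul_eq_mul]
    field_simp
  refine le_of_mul_le_mul_left ?_ hA0
  rw [← abs_of_pos hA0, ← abs_mul, abs_of_pos hA0, hsplit, Finset.mul_sum]
  refine (Finset.abs_sum_le_sum_abs _ _).trans (Finset.sum_le_sum fun u hu => ?_)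
  have hu := (Finset.mem_filter.1 hu).2
  have : Nonempty {i // i ∈ u} := hu.to_subtype
  obtain ⟨c, hc⟩ := exists_bound_marginal b p u hf
  have hv := hvar u hu
  rw [localVar, if_neg hu.ne_empty] at hv
  have h := (hx.restrict hb0 u).abs_sum_integral_altSum_le hb (measurable_marginal b p u hf) hc
    (hα u hu) (hW u) hv
  rw [Fintype.card_coe] at h
  refine h.trans_eq ?_
  ring

/-- Comparison with the constants of the error bound. -/
lemma bound_le_errConst {b : ℕ} (hb : 2 ≤ b) (p : Fin s → ℤ × ℤ) {α W : ℝ} (hα : 1 / 2 < α)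
    (hα1 : α ≤ 1) (hW : 0 ≤ W) {u : Finset (Fin s)} (hu : u.Nonempty) (M : ℕ) :
    ((M + u.card - 1).choose (u.card - 1) : ℝ) *
        ((∏ i : {i // i ∈ u}, (b : ℝ) ^ (p i).1) ^ (α + 1 / 2) * (b : ℝ) ^ (-α * M) *
        (((b : ℝ) - 1) ^ (α - 1 / 2) * (b : ℝ) ^ (1 / 2 : ℝ)) ^ (u.card - 1) * W) ≤
      W * errConst b α u p * (b : ℝ) ^ (-α * M) * ((M + u.card).choose (u.card - 1) : ℝ) := by
  have hb2 : (2 : ℝ) ≤ b := by exact_mod_cast hb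
  have hb0 : (0 : ℝ) < b := by linarith
  have hb1 : (1 : ℝ) ≤ (b : ℝ) - 1 := by linarith
  have hb1' : (0 : ℝ) < (b : ℝ) - 1 := by linarith
  have h1 : (((b : ℝ) - 1) ^ (α - 1 / 2) * (b : ℝ) ^ (1 / 2 : ℝ)) ^ (u.card - 1) ≤
      ((b : ℝ) - 1) ^ ((α - 1 / 2) * (u.card : ℝ)) * (b : ℝ) ^ ((u.card : ℝ) / 2) *
        (b : ℝ) ^ (1 / 2 - α) := by
    have e : ((b : ℝ) - 1) ^ ((α - 1 / 2) * (u.card : ℝ)) * (b : ℝ) ^ ((u.card : ℝ) / 2) =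
        (((b : ℝ) - 1) ^ (α - 1 / 2) * (b : ℝ) ^ (1 / 2 : ℝ)) ^ (u.card - 1) *
          (((b : ℝ) - 1) ^ (α - 1 / 2) * (b : ℝ) ^ (1 / 2 : ℝ)) := by
      rw [← pow_succ, Nat.sub_add_cancel hu.card_pos, mul_pow, ← Real.rpow_natCast,
        ← Real.rpow_natCast, ← Real.rpow_mul hb1'.le, ← Real.rpow_mul hb0.le]
      congr 2
      ring
    rw [e, mul_assoc]
    refine le_mul_of_one_le_right (by positivity) ?_
    rw [mul_assoc, ← Real.rpow_add hb0]
    exact one_le_mul_of_one_le_of_one_le (Real.one_le_rpow hb1 (by linarith))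
      (Real.one_le_rpow (by linarith) (by linarith))
  have h2 : (∏ i : {i // i ∈ u}, (b : ℝ) ^ (p i).1) ^ (α + 1 / 2) =
      (b : ℝ) ^ ((α + 1 / 2) * ((∑ i ∈ u, (p i).1 : ℤ) : ℝ)) := by
    rw [prod_zpow_eq_rpow (by omega), ← Real.rpow_mul hb0.le, mul_comm (α + 1 / 2),
      Finset.sum_coe_sort u fun i => (p i).1]
  have h3 : ((M + u.card - 1).choose (u.card - 1) : ℝ) ≤ ((M + u.card).choose (u.card - 1) : ℝ) := by
    exact_mod_cast Nat.choose_le_choose _ (Nat.sub_le _ _)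
  rw [h2, errConst]
  set X := (b : ℝ) ^ ((α + 1 / 2) * ((∑ i ∈ u, (p i).1 : ℤ) : ℝ))
  set Y := ((b : ℝ) - 1) ^ ((α - 1 / 2) * (u.card : ℝ)) * (b : ℝ) ^ ((u.card : ℝ) / 2) *
        (b : ℝ) ^ (1 / 2 - α)
  calc _ ≤ ((M + u.card).choose (u.card - 1) : ℝ) * (X * (b : ℝ) ^ (-α * M) * Y * W) := by
        gcongr
    _ = _ := by ring

end

/-! ### Bounds for the pieces of a function by its variation -/

section
variable {s b : ℕ} {D : Fin s → Set (ℤ × ℤ)} {α γ : Finset (Fin s) → (Fin s → ℤ × ℤ) → ℝ}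

lemma localVar_le_mul_hkVar {p : Fin s → ℤ × ℤ} (hp : p ∈ prodCodes D) (u : Finset (Fin s))
    (hγ : 0 < γ u p) (f : (Fin s → ℝ) → ℝ) :
    localVar b (α u p) p u f ≤ ENNReal.ofReal (γ u p) * hkVar b D α γ f := by
  have h1 : ENNReal.ofReal (γ u p)⁻¹ * localVar b (α u p) p u f ≤ hkVar b D α γ f := by
    calc ENNReal.ofReal (γ u p)⁻¹ * localVar b (α u p) p u f
        = ((ENNReal.ofReal (γ u p)⁻¹ * localVar b (α u p) p u f) ^ 2) ^ (1 / 2 : ℝ) := by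
          rw [← ENNReal.rpow_two, ← ENNReal.rpow_mul]; norm_num
      _ ≤ _ := by
          refine ENNReal.rpow_le_rpow ?_ (by norm_num)
          refine le_trans ?_ (ENNReal.le_tsum (⟨p, hp⟩ : prodCodes D))
          exact Finset.single_le_sum (f := fun u =>
            (ENNReal.ofReal (γ u p)⁻¹ * localVar b (α u p) p u f) ^ 2)
            (fun _ _ => zero_le) (Finset.mem_univ u)
  calc localVar b (α u p) p u f
      = ENNReal.ofReal (γ u p) * (ENNReal.ofReal (γ u p)⁻¹ * localVar b (α u p) p u f) := by
        rw [← mul_assoc, ← ENNReal.ofReal_mul hγ.le, mul_inv_cancel₀ hγ.ne', ENNReal.ofReal_one,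
          one_mul]
    _ ≤ _ := by gcongr

lemma lintegral_box_le (hb : 0 < b) {p : Fin s → ℤ × ℤ} (hp : p ∈ prodCodes D)
    (hγ : 0 < γ ∅ p) {f : (Fin s → ℝ) → ℝ} (hf : Continuous f) :
    ∫⁻ z in box b p, ‖f z‖ₑ ≤
      ENNReal.ofReal ((b : ℝ) ^ (((∑ i, (p i).1 : ℤ) : ℝ) / 2) * γ ∅ p) * hkVar b D α γ f := by
  have hbR : (0 : ℝ) < b := by exact_mod_cast hb
  have h := ENNReal.lintegral_mul_le_Lp_mul_Lq (volume.restrict (box b p))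
    Real.HolderConjugate.two_two (f := fun _ => 1) (g := fun z => ‖f z‖ₑ)
    aemeasurable_const hf.measurable.enorm.aemeasurable
  have hv := localVar_le_mul_hkVar (b := b) (α := α) hp ∅ hγ f
  rw [localVar, if_pos rfl] at hv
  simp only [Pi.mul_apply, lintegral_const, ENNReal.rpow_two, one_pow, one_mul,
    Measure.restrict_apply_univ, volume_box, prod_zpow_eq_rpow hb] at h
  refine h.trans ?_
  rw [ENNReal.ofReal_rpow_of_pos (by positivity), ← Real.rpow_mul hbR.le, mul_one_div,
    ENNReal.ofReal_mul (by positivity), mul_assoc]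
  gcongr

end

/-! ### The worst-case error -/

section
variable {s b : ℕ} {D : Fin s → Set (ℤ × ℤ)}

lemma pairwiseDisjoint_box (hD : ∀ i, IsPartitionOfReal b (D i)) :
    (prodCodes D).PairwiseDisjoint (box b) := by
  intro p hp p' hp' hne
  obtain ⟨i, hi⟩ := Function.ne_iff.1 hne
  have h : Disjoint (interval b (p i)) (interval b (p' i)) := (hD i).1 (hp i) (hp' i) hi
  exact Set.disjoint_left.2 fun x hx hx' => Set.disjoint_left.1 h (hx i) (hx' i)

lemma exists_mem_box (hD : ∀ i, IsPartitionOfReal b (D i)) (x : Fin s → ℝ) :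
    ∃ p ∈ prodCodes D, x ∈ box b p := by
  have h : ∀ i, ∃ q ∈ D i, x i ∈ interval b q := fun i => by
    have : x i ∈ ⋃ q ∈ D i, interval b q := (hD i).2 ▸ Set.mem_univ _
    simpa using this
  choose p hp hx using h
  exact ⟨p, hp, hx⟩

/-- Outside the boxes in `F`, the `L_1`-norm is controlled by the truncation sum. -/
lemma lintegral_compl_le (hb : 0 < b) (hD : ∀ i, IsPartitionOfReal b (D i))
    {α γ : Finset (Fin s) → (Fin s → ℤ × ℤ) → ℝ} (hγ : IsLocalWeight D γ)
    (F : Set (Fin s → ℤ × ℤ)) {f : (Fin s → ℝ) → ℝ} (hf : Continuous f) :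
    ∫⁻ z in (⋃ p ∈ F, box b p)ᶜ, ‖f z‖ₑ ≤ truncationSum b D F γ * hkVar b D α γ f := by
  have hsub : (⋃ p ∈ F, box b p)ᶜ ⊆
      ⋃ p : (prodCodes D \ F : Set (Fin s → ℤ × ℤ)), box b p.1 := by
    intro x hx
    obtain ⟨p, hp, hxp⟩ := exists_mem_box hD x
    refine Set.mem_iUnion.2 ⟨⟨p, hp, fun hF => hx ?_⟩, hxp⟩
    exact Set.mem_biUnion hF hxp
  calc ∫⁻ z in (⋃ p ∈ F, box b p)ᶜ, ‖f z‖ₑ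
      ≤ ∫⁻ z in ⋃ p : (prodCodes D \ F : Set (Fin s → ℤ × ℤ)), box b p.1, ‖f z‖ₑ :=
        lintegral_mono_set hsub
    _ ≤ ∑' p : (prodCodes D \ F : Set (Fin s → ℤ × ℤ)), ∫⁻ z in box b p.1, ‖f z‖ₑ :=
        lintegral_iUnion_le _ _
    _ ≤ _ := by
        rw [truncationSum, ← ENNReal.tsum_mul_right]
        exact ENNReal.tsum_le_tsum fun p => lintegral_box_le hb p.2.1 ((hγ ∅).1 _ p.2.1) hf

end

section
variable {b m s t : ℕ} {Δ : Fin s → ℕ} {e : (i : Fin s) → Fin (Δ i) → ℤ × ℤ}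
  {μ : (i : Fin s) → Fin (Δ i) → ℕ}

/-- The index vectors `d` of the boxes in `F`. -/
def goodIndexVectors (t m : ℕ) (μ : (i : Fin s) → Fin (Δ i) → ℕ) :
    Finset ((i : Fin s) → Fin (Δ i)) :=
  Finset.univ.filter fun d => (t : ℤ) ≤ mIndex m μ d

lemma biUnion_goodCodes (b : ℕ) (e : (i : Fin s) → Fin (Δ i) → ℤ × ℤ) :
    (⋃ p ∈ goodCodes t m e μ, box b p) = ⋃ d ∈ goodIndexVectors t m μ, box b (boxCode e d) := by
  ext x
  simp only [goodCodes, goodIndexVectors, Set.mem_iUnion, Set.mem_ofPred_eq, Finset.mem_filter,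
    Finset.mem_univ, true_and, exists_prop]
  constructor
  · rintro ⟨p, ⟨d, hd, rfl⟩, hx⟩
    exact ⟨d, hd, hx⟩
  · rintro ⟨d, hd, hx⟩
    exact ⟨_, ⟨d, hd, rfl⟩, hx⟩

lemma integrable_of_truncationSum_lt_top (hb : 0 < b) {D : Fin s → Set (ℤ × ℤ)}
    (hD : ∀ i, IsPartitionOfReal b (D i))
    {α γ : Finset (Fin s) → (Fin s → ℤ × ℤ) → ℝ} (hγ : IsLocalWeight D γ)
    (hT : truncationSum b D (goodCodes t m e μ) γ < ∞) {f : (Fin s → ℝ) → ℝ}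
    (hf : f ∈ spaceH b D α γ) : Integrable f := by
  have h1 : IntegrableOn f (⋃ p ∈ goodCodes t m e μ, box b p) := by
    rw [biUnion_goodCodes, integrableOn_finset_iUnion]
    exact fun d _ => integrableOn_box_of_continuous b _ hf.1
  have h2 : IntegrableOn f (⋃ p ∈ goodCodes t m e μ, box b p)ᶜ :=
    ⟨hf.1.aestronglyMeasurable,
      (lintegral_compl_le hb hD hγ _ hf.1).trans_lt (ENNReal.mul_lt_top hT hf.2)⟩
  rw [← integrableOn_univ, ← Set.union_compl_self (⋃ p ∈ goodCodes t m e μ, box b p)]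
  exact h1.union h2

open Classical in
/-- The quadrature rule is the sum over the boxes in `F` of equal weight rules. -/
lemma quadRule_eq_sum {D : Fin s → Set (ℤ × ℤ)}
    (hD : ∀ i, IsPartitionOfReal b (D i)) (he : ∀ i, Function.Injective (e i))
    (heD : ∀ i d, e i d ∈ D i) (C : Fin s → Matrix (Fin m) (Fin m) (ZMod b))
    {lam : Fin (b ^ m) → ℝ}
    (hlam : IsLocallyEqualWeights b D (netPoint C e μ) (goodIndices t C e μ) lam)
    (hb : 0 < b) (f : (Fin s → ℝ) → ℝ) :
    quadRule (netPoint C e μ) (goodIndices t C e μ) lam f =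
      ∑ d ∈ goodIndexVectors t m μ, (∏ i, (b : ℝ) ^ (boxCode e d i).1) /
        (Finset.univ.filter fun n => netPoint C e μ n ∈ box b (boxCode e d)).card *
        ∑ n ∈ Finset.univ.filter fun n => netPoint C e μ n ∈ box b (boxCode e d),
          f (netPoint C e μ n) := by
  have hcode : ∀ d : (i : Fin s) → Fin (Δ i), boxCode e d ∈ prodCodes D := fun d i => heD i (d i)
  have hunion : goodIndices t C e μ = (goodIndexVectors t m μ).biUnion fun d =>
      Finset.univ.filter fun n => netPoint C e μ n ∈ box b (boxCode e d) := by
    ext n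
    rw [goodIndices, Finset.mem_filter, Finset.mem_biUnion]
    simp only [goodIndexVectors, Finset.mem_filter, Finset.mem_univ, true_and]
    constructor
    · rintro ⟨p, ⟨d, hd, rfl⟩, hx⟩
      exact ⟨d, hd, hx⟩
    · rintro ⟨d, hd, hx⟩
      exact ⟨_, ⟨d, hd, rfl⟩, hx⟩
  have hmem : ∀ d ∈ goodIndexVectors t m μ, ∀ n, netPoint C e μ n ∈ box b (boxCode e d) →
      n ∈ goodIndices t C e μ := by
    intro d hd n hn
    rw [hunion]
    exact Finset.mem_biUnion.2 ⟨d, hd, Finset.mem_filter.2 ⟨Finset.mem_univ _, hn⟩⟩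
  rw [quadRule]
  conv_lhs => rw [hunion]
  rw [Finset.sum_biUnion]
  · refine Finset.sum_congr rfl fun d hd => ?_
    rw [Finset.mul_sum]
    refine Finset.sum_congr rfl fun n hn => ?_
    have hn := (Finset.mem_filter.1 hn).2
    rw [hlam _ (hcode d) n (hmem d hd n hn) hn, ← Set.ncard_coe_finset]
    have hprod : ∏ i, (b : ℝ) ^ (boxCode e d i).1 = (b : ℝ) ^ ∑ i, (boxCode e d i).1 := by
      rw [prod_zpow_eq_rpow hb, Real.rpow_intCast]
    rw [hprod]
    congr 4
    ext n'
    simp only [Set.mem_ofPred_eq, Finset.coe_filter, Finset.mem_univ, true_and,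
      and_iff_right_iff_imp]
    exact hmem d hd n'
  · intro d _ d' _ hne
    refine Finset.disjoint_left.2 fun n hn hn' => ?_
    have hne' : boxCode e d ≠ boxCode e d' := fun h => hne (funext fun i => he i (congrFun h i))
    exact Set.disjoint_left.1 (pairwiseDisjoint_box hD (hcode d) (hcode d') hne')
      (Finset.mem_filter.1 hn).2 (Finset.mem_filter.1 hn').2

open Classical in
/-- The error bound for the rule that uses the points in the boxes of `F`. -/
lemma worstCaseError_le (hb : 2 ≤ b) (hs : 1 ≤ s) {D : Fin s → Set (ℤ × ℤ)}
    (hD : ∀ i, IsPartitionOfReal b (D i)) (he : ∀ i, Function.Injective (e i))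
    (heD : ∀ i d, e i d ∈ D i) (hμ_anti : ∀ i, Antitone (μ i)) (hμ_le : ∀ i d, μ i d ≤ m)
    (hμ_sum : ∀ i, ∑ d, b ^ μ i d = b ^ m)
    {C : Fin s → Matrix (Fin m) (Fin m) (ZMod b)} (hC : IsDigitalNet t C)
    {α γ : Finset (Fin s) → (Fin s → ℤ × ℤ) → ℝ} (hα : IsLocalSmoothness D α)
    (hγ : IsLocalWeight D γ) {lam : Fin (b ^ m) → ℝ}
    (hlam : IsLocallyEqualWeights b D (netPoint C e μ) (goodIndices t C e μ) lam) :
    worstCaseError b D α γ (quadRule (netPoint C e μ) (goodIndices t C e μ) lam) ≤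
      truncationSum b D (goodCodes t m e μ) γ + approximationSum b t m e μ α γ := by
  have hb0 : 0 < b := by omega
  have : NeZero b := ⟨hb0.ne'⟩
  have hcode : ∀ d : (i : Fin s) → Fin (Δ i), boxCode e d ∈ prodCodes D := fun d i => heD i (d i)
  refine iSup₂_le fun f hf => ?_
  obtain ⟨⟨hcont, hfin⟩, hvar1⟩ := hf
  rcases eq_or_ne (truncationSum b D (goodCodes t m e μ) γ) ∞ with hT | hT
  · rw [hT, top_add]; exact le_top
  have hint : Integrable f :=
    integrable_of_truncationSum_lt_top hb0 hD hγ (lt_top_iff_ne_top.2 hT) ⟨hcont, hfin⟩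
  set G := goodIndexVectors t m μ with hG
  set U := ⋃ p ∈ goodCodes t m e μ, box b p with hU
  have hUm : MeasurableSet U := by
    rw [hU, biUnion_goodCodes]
    exact Finset.measurableSet_biUnion _ fun d _ => measurableSet_box _ _
  have hsplit : ∫ z, f z = ∑ d ∈ G, (∫ z in box b (boxCode e d), f z) + ∫ z in Uᶜ, f z := by
    rw [← integral_add_compl hUm hint, hU, biUnion_goodCodes, integral_biUnion_finset]
    · exact fun d _ => measurableSet_box _ _
    · intro d _ d' _ hne
      exact pairwiseDisjoint_box hD (hcode d) (hcode d')
        fun h => hne (funext fun i => he i (congrFun h i))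
    · exact fun d _ => hint.integrableOn
  rw [quadRule_eq_sum hD he heD C hlam hb0, hsplit, ← sub_sub, ← Finset.sum_sub_distrib]
  set E : ((i : Fin s) → Fin (Δ i)) → ℝ := fun d => (∏ i, (b : ℝ) ^ (boxCode e d i).1) /
        (Finset.univ.filter fun n => netPoint C e μ n ∈ box b (boxCode e d)).card *
        ∑ n ∈ Finset.univ.filter (fun n => netPoint C e μ n ∈ box b (boxCode e d)),
          f (netPoint C e μ n) - ∫ z in box b (boxCode e d), f z with hE
  have htrunc : ENNReal.ofReal |∫ z in Uᶜ, f z| ≤ truncationSum b D (goodCodes t m e μ) γ := by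
    rw [← Real.enorm_eq_ofReal_abs]
    refine (enorm_integral_le_lintegral_enorm _).trans
      ((lintegral_compl_le (α := α) hb0 hD hγ _ hcont).trans ?_)
    exact mul_le_of_le_one_right' hvar1
  have hloc : ∀ d ∈ G, ENNReal.ofReal |E d| ≤ ∑ u : Finset (Fin s) with u.Nonempty,
      ENNReal.ofReal (γ u (boxCode e d) * errConst b (α u (boxCode e d)) u (boxCode e d) *
        (b : ℝ) ^ (-(α u (boxCode e d)) * ((mIndex m μ d - t : ℤ) : ℝ)) *
        (((mIndex m μ d - t).toNat + u.card).choose (u.card - 1) : ℝ)) := by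
    intro d hd
    have hd := (Finset.mem_filter.1 hd).2
    have hαd : ∀ u : Finset (Fin s), u.Nonempty → 1 / 2 < α u (boxCode e d) := fun u hu => by
      obtain ⟨c, hc, hc'⟩ := (hα u hu).2
      exact hc.trans_le (hc' _ (hcode d))
    have hγd : ∀ u : Finset (Fin s), 0 < γ u (boxCode e d) := fun u => (hγ u).1 _ (hcode d)
    obtain ⟨hnet, hne⟩ :=
      isLocalNet_netPoint hs (fun i => (hD i).1) he heD hμ_anti hμ_le hμ_sum hC d hd
    have hbound := hnet.abs_error_le hb hne hcont hαd (fun u => (hγd u).le) fun u _ =>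
      (localVar_le_mul_hkVar (hcode d) u (hγd u) f).trans (mul_le_of_le_one_right' hvar1)
    have hM : (((mIndex m μ d - t).toNat : ℕ) : ℝ) = ((mIndex m μ d - t : ℤ) : ℝ) := by
      have : (((mIndex m μ d - t).toNat : ℕ) : ℤ) = mIndex m μ d - t :=
        Int.toNat_of_nonneg (by omega)
      exact_mod_cast congrArg (Int.cast : ℤ → ℝ) this
    refine (ENNReal.ofReal_le_ofReal (hbound.trans (Finset.sum_le_sum fun u hu =>
      bound_le_errConst hb _ (hαd u (Finset.mem_filter.1 hu).2)
        ((hα u (Finset.mem_filter.1 hu).2).1 _ (hcode d)) (hγd u).le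
        (Finset.mem_filter.1 hu).2 _))).trans ?_
    simp only [hM]
    exact Finset.le_sum_of_subadditive _ ENNReal.ofReal_zero.le (fun _ _ => ENNReal.ofReal_add_le) _ _
  calc ENNReal.ofReal |∑ d ∈ G, E d - ∫ z in Uᶜ, f z|
      ≤ ENNReal.ofReal (∑ d ∈ G, |E d| + |∫ z in Uᶜ, f z|) :=
        ENNReal.ofReal_le_ofReal ((abs_sub _ _).trans
          (add_le_add_left (Finset.abs_sum_le_sum_abs _ _) _))
    _ ≤ ∑ d ∈ G, ENNReal.ofReal |E d| + ENNReal.ofReal |∫ z in Uᶜ, f z| := by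
        refine ENNReal.ofReal_add_le.trans ?_
        gcongr
        exact (ENNReal.ofReal_sum_of_nonneg fun _ _ => abs_nonneg _).le
    _ ≤ approximationSum b t m e μ α γ + truncationSum b D (goodCodes t m e μ) γ := by
        refine add_le_add ((Finset.sum_le_sum hloc).trans_eq ?_) htrunc
        rw [approximationSum, Finset.sum_comm]
        rfl
    _ = _ := add_comm _ _

end

end QMCNet

theorem mainTheorem1 (b : ℕ) [Fact b.Prime] (s m t : ℕ) (hs : 1 ≤ s) (hm : 1 ≤ m)
    -- the product partition
    (D : Fin s → Set (ℤ × ℤ)) (hD : ∀ i, QMCNet.IsPartitionOfReal b (D i))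
    -- the chosen intervals and the numbers of points placed in them
    (Δ : Fin s → ℕ) (e : (i : Fin s) → Fin (Δ i) → ℤ × ℤ)
    (he : ∀ i, Function.Injective (e i)) (heD : ∀ i d, e i d ∈ D i)
    (μ : (i : Fin s) → Fin (Δ i) → ℕ) (hμ_anti : ∀ i, Antitone (μ i))
    (hμ_le : ∀ i d, μ i d ≤ m) (hμ_ge : ∀ i d, t ≤ μ i d)
    (hμ_sum : ∀ i, ∑ d, b ^ μ i d = b ^ m)
    -- the digital net
    (C : Fin s → Matrix (Fin m) (Fin m) (ZMod b)) (hC : QMCNet.IsDigitalNet t C)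
    -- the function class
    (α γ : Finset (Fin s) → (Fin s → ℤ × ℤ) → ℝ)
    (hα : QMCNet.IsLocalSmoothness D α) (hγ : QMCNet.IsLocalWeight D γ) :
    -- the functions are integrable if the truncation sum is finite
    (QMCNet.truncationSum b D (QMCNet.goodCodes t m e μ) γ < ⊤ →
      ∀ f ∈ QMCNet.spaceH b D α γ, MeasureTheory.Integrable f) ∧
    -- the rule that uses the points lying in the boxes of `F`
    (∀ lam : Fin (b ^ m) → ℝ,
      QMCNet.IsLocallyEqualWeights b D (QMCNet.netPoint C e μ)
        (QMCNet.goodIndices t C e μ) lam →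
      QMCNet.worstCaseError b D α γ
        (QMCNet.quadRule (QMCNet.netPoint C e μ) (QMCNet.goodIndices t C e μ) lam) ≤
      QMCNet.truncationSum b D (QMCNet.goodCodes t m e μ) γ +
        QMCNet.approximationSum b t m e μ α γ) ∧
    -- the rule that uses all points, if none of them lies outside the boxes of `F`
    ((∀ n : Fin (b ^ m), ∃ p ∈ QMCNet.goodCodes t m e μ, QMCNet.netPoint C e μ n ∈ QMCNet.box b p) →
      ∀ lam : Fin (b ^ m) → ℝ,
      QMCNet.IsLocallyEqualWeights b D (QMCNet.netPoint C e μ) Finset.univ lam →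
      QMCNet.worstCaseError b D α γ
        (QMCNet.quadRule (QMCNet.netPoint C e μ) Finset.univ lam) ≤
      QMCNet.truncationSum b D (QMCNet.goodCodes t m e μ) γ +
        QMCNet.approximationSum b t m e μ α γ) := by
  have hprime : b.Prime := Fact.out
  have hb : 2 ≤ b := hprime.two_le
  have hgood : ∀ lam : Fin (b ^ m) → ℝ,
      QMCNet.IsLocallyEqualWeights b D (QMCNet.netPoint C e μ)
        (QMCNet.goodIndices t C e μ) lam →
      QMCNet.worstCaseError b D α γ
        (QMCNet.quadRule (QMCNet.netPoint C e μ) (QMCNet.goodIndices t C e μ) lam) ≤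
      QMCNet.truncationSum b D (QMCNet.goodCodes t m e μ) γ +
        QMCNet.approximationSum b t m e μ α γ := fun lam hlam =>
    QMCNet.worstCaseError_le hb hs hD he heD hμ_anti hμ_le hμ_sum hC hα hγ hlam
  refine ⟨fun hT f hf => QMCNet.integrable_of_truncationSum_lt_top (by omega) hD hγ hT hf, hgood,
    fun hall lam hlam => ?_⟩
  have huniv : QMCNet.goodIndices t C e μ = Finset.univ := by
    unfold QMCNet.goodIndices
    classical exact Finset.filter_true_of_mem fun n _ => hall n
  rw [← huniv] at hlam ⊢
  exact hgood lam hlam
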